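/- **Setting.** Let $n_1,n_2\ge 1$ and $k_1,k_2\ge 0$ be integers, $m_i=n_i+k_i$ $(i=1,2)$, and assume $$m_1m_2\ \ge\ 2n_1n_2+(2n_1-1)(2n_2-1).$$ Let $G=\mathbb Z/m_1\times\mathbb Z/m_2$ be the pixel grid (indices are read cyclically). A sample $\mathbf X\in\mathbb R^{n_1\times n_2}$ occupies a known window $\boldsymbol\Omega=\{o+(i,h):0\le i<n_1,\ 0\le h<n_2\}\subset G$, where $o\in G$. A background is a function $\mathbf Y:G\to\mathbb R$ with $\mathbf Y|_{\boldsymbol\Omega}=0$. The combined image $\mathbf Z$ equals $\mathbf X$ on $\boldsymbol\Omega$ (that is, $\mathbf Z_{o+(i,h)}=\mathbf X_{i,h}$) and $\mathbf Y$ off $\boldsymbol\Omega$. Its intensity is $\mathbf I=|\widehat{\mathbf Z}|^2$ (entrywise), where $\widehat{\mathbf Z}_l=\sum_{q\in G}\mathbf Z_q\,e^{-2\pi \mathrm i(q_1l_1/m_1+q_2l_2/m_2)}$. Let $\mathbf S=\{s\in G:\ (\boldsymbol\Omega+s)\cap\boldsymbol\Omega=\emptyset\}$. For a background $\mathbf Y$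 let $\mathbf M=\mathbf M(\mathbf Y)$ be the real matrix with rows indexed by $s\in\mathbf S$, columns indexed by the pixels $p\in\boldsymbol\Omega$, and entries $\mathbf M_{s,p}=\mathbf Y_{p+s}+\mathbf Y_{p-s}$. For an array $\mathbf I:G\to\mathbb R$ let $\mathbf R_3=\mathbf R_3(\mathbf I,\mathbf Y)$ be the vector with entries $$(\mathbf R_3)_s=\frac1{m_1m_2}\sum_{l\in G}\mathbf I_l\,e^{2\pi \mathrm i(l_1s_1/m_1+l_2s_2/m_2)}-\sum_{q\in G}\mathbf Y_{q-s}\mathbf Y_q ,\qquad s\in\mathbf S .$$ **Noise model.** The values $\mathbf Y_q$, $q\notin\boldsymbol\Omega$, are i.i.d. $\mathcal N(\mu,\sigma^2)$ with $\sigma>0$, and $\mathbf X$ is fixed. One knows $\tilde{\mathbf I}=\mathbf I+\boldsymbol\varepsilon_1$ and $\tilde{\mathbf Y}=\mathbf Y+\boldsymbol\varepsilon_2$. Here $\boldsymbol\varepsilon_1,\boldsymbol\varepsilon_2$ are random real arrays on $G$ with $\max|\boldsymbol\varepsilon_1|\le c_1$ and $\max|\boldsymbol\varepsilon_2|\le c_2$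 almost surely, $\boldsymbol\varepsilon_2$ vanishes on $\boldsymbol\Omega$, and $\boldsymbol\varepsilon_2$ is independent of $\mathbf Y$. Put $\tilde{\mathbf M}=\mathbf M(\tilde{\mathbf Y})$ and $\tilde{\mathbf R}_3=\mathbf R_3(\tilde{\mathbf I},\tilde{\mathbf Y})$. **Theorem 2.6** (label robustness). For all $n_1,n_2,k_1,k_2$ as above there are continuous functions $C_2:[0,\infty)\to[0,\infty)$ and $C_1:[0,\infty)^2\to[0,\infty)$, depending only on $n_1,n_2,k_1,k_2$, with $C_2(0)=0$ and $C_1(c_1,0)=0$ for all $c_1\ge0$, such that the following holds for all $o,\mathbf X,\mu,\sigma,c_1,c_2$ and all $\mathbf Y,\boldsymbol\varepsilon_1,\boldsymbol\varepsilon_2$ as in the noise model. With probability $1$ the matrix $\tilde{\mathbf M}^{\mathrm T}\tilde{\mathbf M}$ is invertible, and every least-squares estimate $$\mathbf X^*\in\arg\min_{\mathbf X'\in\mathbb R^{n_1\times n_2}}\big\|\tilde{\mathbf M}\,\mathrm{vec}(\mathbf X')-\tilde{\mathbf R}_3\big\|_2^2$$ satisfies $$\|\mathbf X^*-\mathbf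 X\|_{\mathrm F}\le\delta_1\delta_2\left(c_1+c_2\big(2\|\mathrm{vec}(\tilde{\mathbf Y})\|_1+c_2m_1m_2\big)+\frac{\sqrt{C_2(c_2)\,\|\mathrm{vec}(\tilde{\mathbf I})\|_1+C_1(c_1,c_2)}}{m_1m_2}\right),$$ where $\delta_1$ and $\delta_2$ are the largest singular values of $(\tilde{\mathbf M}^{\mathrm T}\tilde{\mathbf M})^{-1}$ and of $\tilde{\mathbf M}$, respectively. -/

import Mathlib

open MeasureTheory ProbabilityTheory
open scoped NNReal Matrix

noncomputable section

namespace BackgroundPR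

/-- The (discrete, periodic) grid on which the full image lives; indices are read modulo
`m₁` and `m₂`. -/
abbrev Grid (m₁ m₂ : ℕ) : Type := ZMod m₁ × ZMod m₂

variable {n₁ n₂ m₁ m₂ : ℕ}

/-- The grid position of the pixel `p = (i, h)` of the unknown sample when the corner of the
sample is placed at `o`. The range of this map is the support window of the sample. -/
def pos (o : Grid m₁ m₂) (p : Fin n₁ × Fin n₂) : Grid m₁ m₂ :=
  o + (((p.1 : ℕ) : ZMod m₁), ((p.2 : ℕ) : ZMod m₂))

/-- The combined image: it equals the sample `X` on the window and the background `Y` elsewhere. -/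
def combine (o : Grid m₁ m₂) (X : Matrix (Fin n₁) (Fin n₂) ℝ) (Y : Grid m₁ m₂ → ℝ) :
    Grid m₁ m₂ → ℝ :=
  Function.extend (pos o) (fun p : Fin n₁ × Fin n₂ => X p.1 p.2) Y

/-- The unnormalised two-dimensional discrete Fourier transform
`l ↦ ∑ q, exp (-2πi (q₁ l₁ / m₁ + q₂ l₂ / m₂)) f q`. -/
def dft₂ [NeZero m₁] [NeZero m₂] (f : Grid m₁ m₂ → ℂ) (l : Grid m₁ m₂) : ℂ :=
  ∑ q : Grid m₁ m₂, ZMod.stdAddChar (-(q.1 * l.1)) * ZMod.stdAddChar (-(q.2 * l.2)) * f q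

/-- The inverse two-dimensional discrete Fourier transform. -/
def invDft₂ [NeZero m₁] [NeZero m₂] (f : Grid m₁ m₂ → ℂ) (s : Grid m₁ m₂) : ℂ :=
  ((m₁ : ℂ) * (m₂ : ℂ))⁻¹ *
    ∑ l : Grid m₁ m₂, ZMod.stdAddChar (l.1 * s.1) * ZMod.stdAddChar (l.2 * s.2) * f l

/-- The phaseless Fourier intensity of a real image. -/
def intensity [NeZero m₁] [NeZero m₂] (z : Grid m₁ m₂ → ℝ) (l : Grid m₁ m₂) : ℝ :=
  ‖dft₂ (fun q => (z q : ℂ)) l‖ ^ 2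

/-- The circular auto-correlation of a real image. -/
def autocorr [NeZero m₁] [NeZero m₂] (z : Grid m₁ m₂ → ℝ) (s : Grid m₁ m₂) : ℝ :=
  ∑ q : Grid m₁ m₂, z (q - s) * z q

/-- The shifts `s` for which the window and its translate by `s` are disjoint. These are the
shifts at which the circular auto-correlation of the combined image is affine in the sample. -/
def linearShifts (n₁ n₂ : ℕ) (o : Grid m₁ m₂) : Set (Grid m₁ m₂) :=
  {s | ∀ p p' : Fin n₁ × Fin n₂, pos o p + s ≠ pos o p'}

instance [NeZero m₁] [NeZero m₂] (o : Grid m₁ m₂) : Fintype (linearShifts n₁ n₂ o) :=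
  Fintype.ofFinite _

/-- The matrix `M` built from a background: the row of the shift `s` applied to `vec X` is the
part of the auto-correlation at `s` which is linear in `X`. -/
def systemMatrix (o : Grid m₁ m₂) (Y : Grid m₁ m₂ → ℝ) :
    Matrix (linearShifts n₁ n₂ o) (Fin n₁ × Fin n₂) ℝ :=
  Matrix.of fun s p => Y (pos o p + s) + Y (pos o p - s)

/-- The right-hand side `R₃` of the linear system computed from an intensity `I` and a background
`Y` vanishing on the window: the auto-correlation recovered from `I` minus the products of
background values. It is complex valued since the inverse transform of a noisy intensity need not
be real. -/
def rightHandSide [NeZero m₁] [NeZero m₂] (o : Grid m₁ m₂) (I Y : Grid m₁ m₂ → ℝ)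
    (s : linearShifts n₁ n₂ o) : ℂ :=
  invDft₂ (fun l => (I l : ℂ)) s - (autocorr Y s : ℂ)

/-- The sample `Xs` is a solution of the least squares problem
`min ‖M vec X - R₃‖₂²` over real `n₁ × n₂` matrices, where `M` and `R₃` are computed from the
background `Y` and the intensity `I`. -/
def IsLeastSquares [NeZero m₁] [NeZero m₂] (o : Grid m₁ m₂) (I Y : Grid m₁ m₂ → ℝ)
    (Xs : Matrix (Fin n₁) (Fin n₂) ℝ) : Prop :=
  IsMinOn
    (fun X : Matrix (Fin n₁) (Fin n₂) ℝ =>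
      ∑ s : linearShifts n₁ n₂ o,
        ‖(((systemMatrix o Y *ᵥ fun p => X p.1 p.2) s : ℝ) : ℂ) - rightHandSide o I Y s‖ ^ 2)
    Set.univ Xs

/-- The largest singular value of a real matrix (singular values are listed in decreasing order). -/
def maxSingularValue {ι κ : Type*} [Fintype ι] [Fintype κ] [DecidableEq κ]
    (A : Matrix ι κ ℝ) : ℝ :=
  (Matrix.toEuclideanLin A).singularValues 0

/-- The Frobenius norm of a real matrix. -/
def frobNorm {ι κ : Type*} [Fintype ι] [Fintype κ] (A : Matrix ι κ ℝ) : ℝ :=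
  √(∑ i, ∑ j, A i j ^ 2)

/-- The `ℓ¹` norm of the vectorisation of a real image on the grid. -/
def l1Norm [NeZero m₁] [NeZero m₂] (f : Grid m₁ m₂ → ℝ) : ℝ :=
  ∑ q : Grid m₁ m₂, |f q|

end BackgroundPR

end

/-! The error bound is deterministic once the system matrix `M` of the noisy background is
injective. The least-squares estimate is then `(MᵀM)⁻¹Mᵀ` applied to the real part of `R₃`, so its
error is `(MᵀM)⁻¹Mᵀ` applied to the residual of the true sample (`IsLeastSquares.frobNorm_sub_le`).
The residual has a part from the intensity noise, bounded by Parseval, and a part from the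
background bias. The latter is controlled by the `ℓ¹` norm of the combined image, hence by the
intensity (`norm_residual_le`).

The main difficulty is almost sure injectivity. Since `det (L * M(Y))` is polynomial in `Y`, one
background `Y₀` and one matrix `L` with nonzero determinant suffice: on every line in direction `Y₀`
the determinant has finitely many zeros, so its zero set is Lebesgue-null for each fixed value of
the bias. Absolute continuity of the Gaussian law and independence finish the argument.

The pair `L`, `Y₀` comes from counting over a finite field with `q` elements. With `N = m₁m₂`, let
`y` be the spectrum of the background. At the linear shifts `M(Y)X` is the sum over `ξ` of `y ξ`,
the transform of `X` at `ξ`, and the cosine of frequency `ξ`. If every `y` annihilated some nonzero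
`X`, there would be at least `(q - 1) q ^ N` pairs `(X, y)` with zero image. Sort the samples by the
symmetric set `A` of frequencies where the transform vanishes together with its negative. By
`exists_frequencies` there are sets `C`, `D` with `|C| ≤ |D|` such that the values on `C` determine
`X`, leaving at most `q ^ |C|` samples, while the cosines from `D` are independent and force a
kernel of size at most `q ^ (N - |D|)`. Thus each of the `2 ^ N` sets contributes at most `q ^ N`
pairs, impossible for `q > 2 ^ N + 1`.

The sets `C` and `D` are built row by row from one-dimensional interpolation: `n` zeros kill a
polynomial with `n` consecutive frequencies, `2n - 1` zeros kill one with spectrum in the window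
differences, and `n` zeros in a half system suffice if it is even. The size hypothesis on the grid
yields `|C| ≤ |D|` through `exists_rows`. -/

namespace BackgroundPR

/-! ### Interpolation on a cyclic group over a field. -/

section OneDimensional

variable {m : ℕ} [NeZero m] {F : Type*} [Field F] {ψ : AddChar (ZMod m) F}

lemma injective_of_isPrimitive (hψ : ψ.IsPrimitive) : Function.Injective ψ := by
  intro a b hab
  have h : ψ (a - b) = 1 := by
    rw [AddChar.map_sub_eq_div, hab, div_self (AddChar.val_isUnit ψ b).ne_zero]
  exact sub_eq_zero.1 ((hψ.zmod_char_eq_one_iff m _).1 h)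

/-- Inversion of the discrete Fourier transform on `ZMod m` with values in a field. -/
lemma sum_sum_addChar_mul (hψ : ψ.IsPrimitive) (β : ZMod m → F) (i : ZMod m) :
    ∑ s, (∑ j, β j * ψ (j * s)) * ψ (-(i * s)) = m * β i := by
  have h (j : ZMod m) : ∑ s, ψ (s * (j - i)) = if j = i then (m : F) else 0 := by
    rw [AddChar.sum_mulShift _ hψ]
    simp [sub_eq_zero, ZMod.card]
  calc ∑ s, (∑ j, β j * ψ (j * s)) * ψ (-(i * s))
      = ∑ s, ∑ j, β j * ψ (s * (j - i)) := by
        refine Finset.sum_congr rfl fun s _ => ?_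
        rw [Finset.sum_mul]
        refine Finset.sum_congr rfl fun j _ => ?_
        rw [mul_assoc, ← AddChar.map_add_eq_mul]
        congr 2
        ring
    _ = ∑ j, β j * ∑ s, ψ (s * (j - i)) := by
        rw [Finset.sum_comm]
        simp_rw [Finset.mul_sum]
    _ = m * β i := by
        simp [h, mul_comm]

lemma eq_zero_of_forall_sum_addChar_eq_zero (hψ : ψ.IsPrimitive) (hm : (m : F) ≠ 0)
    {β : ZMod m → F} (h : ∀ s, ∑ j, β j * ψ (j * s) = 0) : β = 0 := by
  funext i
  have := sum_sum_addChar_mul hψ β i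
  simp only [h, zero_mul, Finset.sum_const_zero] at this
  simpa [hm] using this.symm

/-- A trigonometric polynomial with `n` consecutive frequencies and `n` zeros vanishes. -/
lemma eq_zero_of_card_le_of_sum_fin_eq_zero (hψ : ψ.IsPrimitive) {n : ℕ} {x : Fin n → F}
    {Z : Finset (ZMod m)} (hZ : n ≤ Z.card)
    (h : ∀ j ∈ Z, ∑ k : Fin n, x k * ψ (j * (k : ℕ)) = 0) : x = 0 := by
  obtain ⟨Z', hZ', hcard⟩ := Finset.exists_subset_card_eq hZ
  let e := Z'.equivFinOfCardEq hcard
  refine Matrix.eq_zero_of_forall_index_sum_mul_pow_eq_zero (f := fun i => ψ (e.symm i)) ?_ ?_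
  · exact (injective_of_isPrimitive hψ).comp (Subtype.val_injective.comp e.symm.injective)
  · intro i
    rw [← h _ (hZ' (e.symm i).2)]
    refine Finset.sum_congr rfl fun k _ => ?_
    rw [← AddChar.map_nsmul_eq_pow, nsmul_eq_mul, mul_comm ((k : ℕ) : ZMod m)]

/-- The differences of the elements of a window of length `n`. -/
def windowDiff (n m : ℕ) : Set (ZMod m) :=
  {s | ∃ a b : Fin n, ((a : ℕ) : ZMod m) + s = ((b : ℕ) : ZMod m)}

/-- The transform of `β` lives on the `2n - 1` residues from `-(n - 1)` to `n - 1`. By inversion `β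
i` is, up to a unit, a polynomial of degree below `2n - 1` in `ψ (-i)`, so that many zeros force it
to vanish. If `m ≤ 2n - 1`, these residues may wrap around, but then all points are zeros. -/
lemma eq_zero_of_support_subset_windowDiff (hψ : ψ.IsPrimitive) (hm : (m : F) ≠ 0) {n : ℕ}
    (hn : 1 ≤ n) {β : ZMod m → F} (hβ : ∀ s ∉ windowDiff n m, ∑ j, β j * ψ (j * s) = 0)
    {Z : Finset (ZMod m)} (hZ : min m (2 * n - 1) ≤ Z.card) (h : ∀ j ∈ Z, β j = 0) : β = 0 := by
  rcases le_or_gt m (2 * n - 1) with hmn | hmn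
  · rw [min_eq_left hmn] at hZ
    have : Z = Finset.univ := by
      rw [← Finset.card_eq_iff_eq_univ, ZMod.card]
      exact le_antisymm (by simpa [ZMod.card] using Finset.card_le_univ Z) hZ
    funext j
    exact h j (this ▸ Finset.mem_univ j)
  rw [min_eq_right hmn.le] at hZ
  set g : ZMod m → F := fun s => ∑ j, β j * ψ (j * s) with hg
  let τ : Fin (2 * n - 1) → ZMod m := fun k => ((k : ℕ) : ZMod m) - ((n - 1 : ℕ) : ZMod m)
  have hτ : Function.Injective τ := by
    intro k l hkl
    have : ((k : ℕ) : ZMod m) = ((l : ℕ) : ZMod m) := sub_left_injective hkl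
    rw [ZMod.natCast_eq_natCast_iff', Nat.mod_eq_of_lt (by omega), Nat.mod_eq_of_lt (by omega)]
      at this
    exact Fin.ext this
  have hrange (s : ZMod m) (hs : s ∉ Set.range τ) : g s = 0 := by
    apply hβ
    rintro ⟨a, b, hab⟩
    refine hs ⟨⟨b + (n - 1 - a), by omega⟩, ?_⟩
    have ha : (a : ℕ) ≤ n - 1 := by omega
    simp only [τ]
    push_cast [Nat.cast_sub ha]
    rw [← hab]
    ring
  have hg0 : (fun k => g (τ k)) = 0 := by
    refine eq_zero_of_card_le_of_sum_fin_eq_zero hψ (m := m)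
      (Z := Z.map (Equiv.neg (ZMod m)).toEmbedding) (by simpa using hZ) fun j hj => ?_
    obtain ⟨i, hi, rfl⟩ := Finset.mem_map.1 hj
    have h1 := sum_sum_addChar_mul hψ β i
    rw [h i hi, mul_zero] at h1
    have h2 : ∑ s, g s * ψ (-(i * s)) = ∑ k, g (τ k) * ψ (-(i * τ k)) :=
      (Fintype.sum_of_injective τ hτ _ _ (fun s hs => by simp [hrange s hs]) fun _ => rfl).symm
    have h3 : ∑ k, g (τ k) * ψ (-(i * τ k)) =
        ψ (i * ((n - 1 : ℕ) : ZMod m)) * ∑ k, g (τ k) * ψ (-i * ((k : ℕ) : ZMod m)) := by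
      rw [Finset.mul_sum]
      refine Finset.sum_congr rfl fun k _ => ?_
      rw [mul_left_comm, ← AddChar.map_add_eq_mul]
      congr 2
      simp only [τ]
      ring
    have h4 : ψ (i * ((n - 1 : ℕ) : ZMod m)) ≠ 0 := (AddChar.val_isUnit ψ _).ne_zero
    rw [← h2, h1] at h3
    simpa [h4] using h3.symm
  refine eq_zero_of_forall_sum_addChar_eq_zero hψ hm fun s => ?_
  by_cases hs : s ∈ Set.range τ
  · obtain ⟨k, rfl⟩ := hs
    exact congrFun hg0 k
  · exact hrange s hs

/-- Representatives of `ZMod m` modulo negation. -/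
def halfReps (m : ℕ) [NeZero m] : Finset (ZMod m) :=
  Finset.univ.filter fun j => 2 * j.val ≤ m

lemma mem_halfReps {j : ZMod m} : j ∈ halfReps m ↔ 2 * j.val ≤ m := by
  simp [halfReps]

lemma card_halfReps (m : ℕ) [NeZero m] : (halfReps m).card = m / 2 + 1 := by
  rw [← Finset.card_range (m / 2 + 1)]
  refine Finset.card_bij (fun j _ => j.val) (fun j hj => ?_) (fun j _ k _ h => ?_) fun k hk => ?_
  · rw [mem_halfReps] at hj
    rw [Finset.mem_range]
    omega
  · exact ZMod.val_injective m h
  · rw [Finset.mem_range] at hk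
    have := NeZero.pos m
    have h : ((k : ZMod m)).val = k := ZMod.val_cast_of_lt (by omega)
    exact ⟨k, by rw [mem_halfReps, h]; omega, h⟩

lemma mem_halfReps_or_neg_mem (j : ZMod m) : j ∈ halfReps m ∨ -j ∈ halfReps m := by
  rw [mem_halfReps, mem_halfReps, ZMod.neg_val]
  have := j.val_lt
  split_ifs <;> omega

lemma eq_of_mem_halfReps {i j : ZMod m} (hi : i ∈ halfReps m) (hj : j ∈ halfReps m)
    (h : i = -j) : i = j := by
  rw [mem_halfReps] at hi hj
  have := j.val_lt
  have h' := congrArg ZMod.val h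
  rw [ZMod.neg_val] at h'
  apply ZMod.val_injective m
  split_ifs at h' with h0
  · simp [h', h0]
  · omega

lemma natAbs_valMinAbs_lt_of_mem_windowDiff {n : ℕ} {s : ZMod m} (hs : s ∈ windowDiff n m) :
    s.valMinAbs.natAbs < n := by
  obtain ⟨a, b, hab⟩ := hs
  have h : ((s.valMinAbs : ℤ) : ZMod m) = (((b : ℕ) - (a : ℕ) : ℤ) : ZMod m) := by
    rw [ZMod.coe_valMinAbs]
    push_cast
    rw [← hab]
    ring
  refine lt_of_le_of_lt (ZMod.natAbs_min_of_le_div_two m _ _ h (ZMod.natAbs_valMinAbs_le s)) ?_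
  omega

open Polynomial in
/-- The Chebyshev polynomials express `ψ (i * s) + ψ (-(i * s))` through `ψ i + ψ (-i)`. -/
lemma two_mul_eval_T {m : ℕ} (h2 : (2 : F) ≠ 0) (ψ : AddChar (ZMod m) F) (i s : ZMod m) :
    2 * (Chebyshev.T F (s.valMinAbs.natAbs : ℕ)).eval ((ψ i + ψ (-i)) / 2)
      = ψ (i * s) + ψ (-(i * s)) := by
  let _ := invertibleOfNonzero h2
  have hinv : ψ i * ψ (-i) = 1 := by
    rw [← AddChar.map_add_eq_mul, add_neg_cancel, AddChar.map_zero_eq_one]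
  have hT : 2 * (Chebyshev.T F (s.valMinAbs.natAbs : ℕ)).eval ((ψ i + ψ (-i)) / 2)
      = ψ i ^ s.valMinAbs.natAbs + ψ (-i) ^ s.valMinAbs.natAbs := by
    rw [chebyshev_T_eq_dickson_one_one]
    simp only [eval_mul, eval_C, eval_comp, eval_ofNat, eval_X]
    rw [mul_div_cancel₀ _ h2, dickson_one_one_eval_add_inv _ _ hinv, ← mul_assoc, mul_invOf_self,
      one_mul]
  rw [hT, ← AddChar.map_nsmul_eq_pow, ← AddChar.map_nsmul_eq_pow, nsmul_eq_mul, nsmul_eq_mul]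
  have hs := ZMod.coe_valMinAbs s
  rcases Int.natAbs_eq s.valMinAbs with h | h
  · have : ((s.valMinAbs.natAbs : ℕ) : ZMod m) = s := by
      rw [← hs]
      conv_rhs => rw [h]
      simp
    rw [this]
    congr 2 <;> ring
  · have : ((s.valMinAbs.natAbs : ℕ) : ZMod m) = -s := by
      rw [← hs]
      conv_rhs => rw [h]
      simp
    rw [this, add_comm]
    congr 2 <;> ring

-- Evenness halves the number of zeros needed: `β` becomes a cosine polynomial of degree below `n`,
-- that is, a combination of Chebyshev polynomials in the variable `(ψ i + ψ (-i)) / 2`, which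
-- separates the half system.
open Polynomial in
lemma eq_zero_of_even_of_support_subset_windowDiff (hψ : ψ.IsPrimitive) (hm : (m : F) ≠ 0)
    (h2 : (2 : F) ≠ 0) {n : ℕ} {β : ZMod m → F} (heven : ∀ j, β (-j) = β j)
    (hβ : ∀ s ∉ windowDiff n m, ∑ j, β j * ψ (j * s) = 0)
    {Z : Finset (ZMod m)} (hZh : Z ⊆ halfReps m) (hZ : min n (halfReps m).card ≤ Z.card)
    (h : ∀ j ∈ Z, β j = 0) : β = 0 := by
  rcases le_or_gt (halfReps m).card n with hmn | hmn
  · rw [min_eq_right hmn] at hZ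
    have : Z = halfReps m := Finset.eq_of_subset_of_card_le hZh hZ
    funext j
    rcases mem_halfReps_or_neg_mem j with hj | hj
    · exact h j (this ▸ hj)
    · rw [← heven]
      exact h _ (this ▸ hj)
  rw [min_eq_left hmn.le] at hZ
  set g : ZMod m → F := fun s => ∑ j, β j * ψ (j * s) with hg
  have hgeven (s : ZMod m) : g (-s) = g s := by
    simp only [hg]
    rw [← Equiv.sum_comp (Equiv.neg (ZMod m))]
    simp [heven]
  let P : F[X] := ∑ s : ZMod m, C (g s) * Chebyshev.T F (s.valMinAbs.natAbs : ℕ)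
  let x : ZMod m → F := fun i => (ψ i + ψ (-i)) / 2
  have heval (i : ZMod m) : P.eval (x i) = m * β i := by
    have h1 := sum_sum_addChar_mul hψ β i
    have h1' : ∑ s, g s * ψ (i * s) = m * β i := by
      rw [← h1, ← Equiv.sum_comp (Equiv.neg (ZMod m))]
      refine Finset.sum_congr rfl fun s _ => ?_
      simp only [Equiv.neg_apply]
      rw [hgeven, mul_neg]
    apply mul_left_cancel₀ h2
    calc 2 * P.eval (x i)
        = ∑ s, g s * (2 * (Chebyshev.T F (s.valMinAbs.natAbs : ℕ)).eval (x i)) := by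
          simp only [P, eval_finsetSum, eval_mul, eval_C, Finset.mul_sum]
          exact Finset.sum_congr rfl fun s _ => by ring
      _ = ∑ s, g s * ψ (i * s) + ∑ s, g s * ψ (-(i * s)) := by
          rw [← Finset.sum_add_distrib]
          refine Finset.sum_congr rfl fun s _ => ?_
          rw [two_mul_eval_T h2, mul_add]
      _ = 2 * (m * β i) := by
          rw [h1', h1]
          ring
  have hinj : Set.InjOn x (halfReps m) := by
    intro i hi j hj hij
    have hij' : ψ i + ψ (-i) = ψ j + ψ (-j) := by
      have := congrArg (· * 2) hij
      simpa [x, h2] using this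
    have hmul (k : ZMod m) : ψ k * ψ (-k) = 1 := by
      rw [← AddChar.map_add_eq_mul, add_neg_cancel, AddChar.map_zero_eq_one]
    -- The sum and the product `1` determine the unordered pair `ψ i`, `ψ (-i)`.
    have hprod : (ψ i - ψ j) * (ψ j - ψ (-i)) = 0 := by
      linear_combination ψ j * hij' - hmul i + hmul j
    rcases mul_eq_zero.1 hprod with h | h
    · exact injective_of_isPrimitive hψ (sub_eq_zero.1 h)
    · have := injective_of_isPrimitive hψ (sub_eq_zero.1 h)
      exact eq_of_mem_halfReps hi hj (by rw [this, neg_neg])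
  have hdeg : P.degree < n := by
    rw [← mem_degreeLT]
    refine Submodule.sum_mem _ fun s _ => mem_degreeLT.2 ?_
    by_cases hs : s ∈ windowDiff n m
    · have : NeZero (2 : F) := ⟨h2⟩
      rw [← smul_eq_C_mul]
      refine lt_of_le_of_lt (degree_smul_le _ _) ?_
      rw [Chebyshev.degree_T]
      exact_mod_cast natAbs_valMinAbs_lt_of_mem_windowDiff hs
    · rw [show g s = 0 from hβ s hs]
      simp
  have hP : P = 0 := by
    classical
    refine eq_zero_of_degree_lt_of_eval_finset_eq_zero (Z.image x) ?_ fun y hy => ?_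
    · rw [Finset.card_image_of_injOn (hinj.mono (by exact_mod_cast hZh))]
      exact lt_of_lt_of_le hdeg (by exact_mod_cast hZ)
    · obtain ⟨i, hi, rfl⟩ := Finset.mem_image.1 hy
      rw [heval, h i hi, mul_zero]
  funext i
  have := heval i
  rw [hP] at this
  simpa [hm] using this.symm

end OneDimensional

/-! ### Combinatorial selection of rows of the dual grid. -/

section Selection

lemma exists_card_eq_forall_le {ι : Type*} [Fintype ι] [DecidableEq ι] (a : ι → ℕ) {n : ℕ}
    (hn : n ≤ Fintype.card ι) :
    ∃ Q : Finset ι, Q.card = n ∧ ∀ i ∈ Q, ∀ j ∉ Q, a j ≤ a i := by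
  induction n with
  | zero => exact ⟨∅, by simp⟩
  | succ n ih =>
    obtain ⟨Q, hQ, hmax⟩ := ih (by omega)
    have hne : (Qᶜ).Nonempty := by
      rw [← Finset.card_pos, Finset.card_compl]
      omega
    obtain ⟨k, hk, hkmax⟩ := Finset.exists_max_image Qᶜ a hne
    rw [Finset.mem_compl] at hk
    refine ⟨insert k Q, by rw [Finset.card_insert_of_notMem hk, hQ], fun i hi j hj => ?_⟩
    rw [Finset.mem_insert, not_or] at hj
    rcases Finset.mem_insert.1 hi with rfl | hi
    · exact hkmax j (Finset.mem_compl.2 hj.2)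
    · exact hmax i hi j hj.2

variable {m : ℕ} [NeZero m]

lemma val_of_eq_neg {i : ZMod m} (hi : i = -i) : i.val = 0 ∨ 2 * i.val = m := by
  have h := congrArg ZMod.val hi
  rw [ZMod.neg_val] at h
  have := i.val_lt
  split_ifs at h with h0
  · exact Or.inl h
  · omega

/-- Only `0` and `m / 2` can equal their own negatives. -/
lemma eq_of_eq_neg {i j k : ZMod m} (hi : i = -i) (hj : j = -j) (hk : k = -k) (hij : i ≠ j)
    (hik : i ≠ k) : j = k := by
  have h (x y : ZMod m) (hxy : x ≠ y) : x.val ≠ y.val := fun h => hxy (ZMod.val_injective m h)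
  by_contra hjk
  have h1 := h _ _ hij
  have h2 := h _ _ hik
  have h3 := h _ _ hjk
  rcases val_of_eq_neg hi with h4 | h4 <;> rcases val_of_eq_neg hj with h5 | h5 <;>
    rcases val_of_eq_neg hk with h6 | h6 <;> omega

/-- The representatives of the two-element orbits of negation. -/
def pairReps (m : ℕ) [NeZero m] : Finset (ZMod m) :=
  (halfReps m).filter fun i => i ≠ -i

lemma mem_pairReps {i : ZMod m} : i ∈ pairReps m ↔ i ∈ halfReps m ∧ i ≠ -i := by
  simp [pairReps]

lemma neg_notMem_pairReps {i : ZMod m} (hi : i ∈ pairReps m) : -i ∉ pairReps m := by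
  rw [mem_pairReps] at hi ⊢
  exact fun h => hi.2 (eq_of_mem_halfReps hi.1 h.1 (neg_neg i).symm)

lemma trichotomy_neg (i : ZMod m) : i = -i ∨ i ∈ pairReps m ∨ -i ∈ pairReps m := by
  by_cases h : i = -i
  · exact Or.inl h
  · refine Or.inr ((mem_halfReps_or_neg_mem i).imp (fun h' => mem_pairReps.2 ⟨h', h⟩) fun h' => ?_)
    exact mem_pairReps.2 ⟨h', fun h'' => h (by rwa [neg_neg, eq_comm] at h'')⟩

lemma le_card_pairReps : m ≤ 2 * (pairReps m).card + 2 := by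
  have hself : (Finset.univ.filter fun i : ZMod m => i = -i).card ≤ 2 := by
    by_contra! h
    obtain ⟨i, j, k, hi, hj, hk, hij, hik, hjk⟩ := Finset.two_lt_card_iff.1 h
    simp only [Finset.mem_filter, Finset.mem_univ, true_and] at hi hj hk
    exact hjk (eq_of_eq_neg hi hj hk hij hik)
  have hcover : (Finset.univ : Finset (ZMod m)) ⊆
      (Finset.univ.filter fun i : ZMod m => i = -i) ∪
        (pairReps m ∪ (pairReps m).map (Equiv.neg (ZMod m)).toEmbedding) := by
    intro i _
    simp only [Finset.mem_union, Finset.mem_filter, Finset.mem_univ, true_and, Finset.mem_map_equiv,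
      Equiv.neg_symm, Equiv.neg_apply]
    exact trichotomy_neg i
  have h1 := Finset.card_le_card hcover
  have h2 := Finset.card_union_le (Finset.univ.filter fun i : ZMod m => i = -i)
    (pairReps m ∪ (pairReps m).map (Equiv.neg (ZMod m)).toEmbedding)
  have h3 := Finset.card_union_le (pairReps m) ((pairReps m).map (Equiv.neg (ZMod m)).toEmbedding)
  rw [Finset.card_map] at h3
  rw [Finset.card_univ, ZMod.card] at h1
  omega

/-- A symmetric set of `min m (2 * n - 1)` residues which contains the symmetric set `H` with
fewer than `n` elements, except possibly for one residue equal to its negative. -/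
lemma exists_symmetric_superset {n : ℕ} (hn : 1 ≤ n) (a : ZMod m → ℕ) {H : Finset (ZMod m)}
    (hH : ∀ i ∈ H, -i ∈ H) (hcard : H.card < n) :
    ∃ R : Finset (ZMod m), R.card = min m (2 * n - 1) ∧ (∀ i ∈ R, -i ∈ R) ∧
      ∀ i ∈ H, i ∉ R → i = -i ∧ ∃ k ∈ R, k = -k ∧ a i ≤ a k := by
  rcases le_or_gt m (2 * n - 1) with hm | hm
  · exact ⟨Finset.univ, by rw [min_eq_left hm, Finset.card_univ, ZMod.card], by simp, by simp⟩
  -- The target size `2n - 1` is odd: take one self-negative residue, with `a` maximal, and `n - 1`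
  -- pairs. Since `H` has fewer than `n` elements, all its pairs fit, and only a second
  -- self-negative residue can be missed.
  obtain ⟨σ, hσ, hσmax⟩ := Finset.exists_max_image
    (Finset.univ.filter fun i : ZMod m => i = -i) a ⟨0, by simp⟩
  simp only [Finset.mem_filter, Finset.mem_univ, true_and] at hσ hσmax
  have h1 : (pairReps m ∩ H).card ≤ n - 1 :=
    (Finset.card_le_card Finset.inter_subset_right).trans (by omega)
  have h2 : n - 1 ≤ (pairReps m).card := by
    have := le_card_pairReps (m := m)
    omega
  obtain ⟨K, hHK, hK, hKcard⟩ := Finset.exists_subsuperset_card_eq Finset.inter_subset_left h1 h2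
  set K' := K.map (Equiv.neg (ZMod m)).toEmbedding with hK'
  have hmem' (i : ZMod m) : i ∈ K' ↔ -i ∈ K := by
    simp [hK', Finset.mem_map_equiv]
  have hdisj : Disjoint K K' := Finset.disjoint_left.2 fun i hi hi' =>
    neg_notMem_pairReps (hK hi) (hK ((hmem' i).1 hi'))
  have hσK : σ ∉ K ∪ K' := by
    rw [Finset.mem_union, hmem', ← hσ, or_self]
    exact fun h => (mem_pairReps.1 (hK h)).2 hσ
  refine ⟨insert σ (K ∪ K'), ?_, ?_, ?_⟩
  · rw [Finset.card_insert_of_notMem hσK, Finset.card_union_of_disjoint hdisj, hK',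
      Finset.card_map, hKcard, min_eq_right hm.le]
    omega
  · intro i hi
    simp only [Finset.mem_insert, Finset.mem_union, hmem', neg_neg] at hi ⊢
    rcases hi with rfl | hi | hi
    · exact Or.inl hσ.symm
    · exact Or.inr (Or.inr hi)
    · exact Or.inr (Or.inl hi)
  · intro i hi hiR
    simp only [Finset.mem_insert, Finset.mem_union, hmem', not_or] at hiR
    rcases trichotomy_neg i with h | h | h
    · exact ⟨h, σ, Finset.mem_insert_self _ _, hσ, hσmax i h⟩
    · exact absurd (hHK (Finset.mem_inter.2 ⟨h, hi⟩)) hiR.2.1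
    · exact absurd (hHK (Finset.mem_inter.2 ⟨h, hH i hi⟩)) hiR.2.2

/-- Here `h` counts the elements above a level and `d` those of them missed by `R`. For `d = 0`,
each unit of `h` removes `2 * n₂` on the left and `t₂` on the right, so `hmain` suffices if `t₂ ≤ 2
* n₂`; otherwise `w₁ ≥ n₁` does. For `d = 1` a further `m₂` is exchanged for `t₂`, which `2 ≤ h`
pays for when `t₂ < n₂`. -/
lemma level_inequality {n₁ n₂ m₂ w₁ w₂ t₁ t₂ h d : ℕ} (hn₁ : n₁ ≤ w₁) (hw₁ : w₁ < 2 * n₁)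
    (hw₂ : w₂ < 2 * n₂) (hm₂ : m₂ = w₂ + t₂) (hmain : 2 * n₁ * n₂ ≤ w₁ * t₂ + t₁ * m₂)
    (hh : h < n₁) (hd : d = 0 ∨ d = 1 ∧ 2 ≤ h ∧ 1 ≤ t₁ ∧ w₁ = 2 * n₁ - 1) :
    2 * n₂ * (n₁ - h) ≤ (w₁ + d - h) * t₂ + (t₁ - d) * m₂ := by
  obtain ⟨k, rfl⟩ := Nat.exists_eq_add_of_lt hh
  rcases hd with rfl | ⟨rfl, h2, ht₁, rfl⟩
  · obtain ⟨u, rfl⟩ := Nat.exists_eq_add_of_le hn₁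
    have e1 : h + k + 1 - h = k + 1 := by omega
    have e2 : h + k + 1 + u + 0 - h = k + 1 + u := by omega
    rw [e1, e2, Nat.sub_zero]
    rcases le_total t₂ (2 * n₂) with ht | ht
    · nlinarith [Nat.mul_le_mul_left h ht]
    · nlinarith [Nat.mul_le_mul_left (k + 1 + u) ht, Nat.zero_le (t₁ * m₂), Nat.zero_le (u * n₂)]
  · obtain ⟨t, rfl⟩ := Nat.exists_eq_add_of_le ht₁
    have e1 : h + k + 1 - h = k + 1 := by omega
    have e2 : 2 * (h + k + 1) - 1 + 1 - h = h + 2 * k + 2 := by omega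
    have e3 : 2 * (h + k + 1) - 1 = 2 * h + 2 * k + 1 := by omega
    rw [e3] at hmain
    rw [e1, e2, Nat.add_sub_cancel_left]
    rcases le_or_gt n₂ t₂ with ht | ht
    · nlinarith [Nat.mul_le_mul_left (2 * k + 2) ht, Nat.zero_le (t * m₂), Nat.zero_le (h * t₂)]
    · obtain ⟨g, rfl⟩ := Nat.exists_eq_add_of_le h2
      obtain ⟨f, rfl⟩ := Nat.exists_eq_add_of_lt ht
      subst hm₂
      have : w₂ ≤ 2 * (t₂ + f) + 1 := by omega
      nlinarith [Nat.zero_le (g * t₂), Nat.zero_le (g * f), Nat.zero_le (t * (w₂ + t₂))]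

/-- The selection of rows behind the nondegeneracy of the system matrix. -/
lemma exists_rows {m₁ m₂ n₁ n₂ : ℕ} [NeZero m₁] (hn₁ : 1 ≤ n₁) (hn₂ : 1 ≤ n₂) (hnm₁ : n₁ ≤ m₁)
    (hnm₂ : n₂ ≤ m₂) (hm : 2 * n₁ * n₂ + (2 * n₁ - 1) * (2 * n₂ - 1) ≤ m₁ * m₂)
    (a : ZMod m₁ → ℕ) (ha : ∀ i, a (-i) = a i) (ham : ∀ i, a i ≤ m₂) :
    ∃ Q R : Finset (ZMod m₁), Q.card = n₁ ∧ R.card = min m₁ (2 * n₁ - 1) ∧ (∀ i ∈ R, -i ∈ R) ∧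
      2 * ∑ i ∈ Q, (n₂ - a i) ≤
        ∑ i, if i ∈ R then min (m₂ - min m₂ (2 * n₂ - 1)) (m₂ - a i) else m₂ - a i := by
  -- The `n₁` rows with the largest `a` have the smallest total deficit.
  obtain ⟨Q, hQ, hQmax⟩ := exists_card_eq_forall_le a (n := n₁) (by rwa [ZMod.card])
  have hQne : Q.Nonempty := by
    rw [← Finset.card_pos]
    omega
  obtain ⟨i₀, hi₀, hmin⟩ := Finset.exists_min_image Q a hQne
  let H := Finset.univ.filter fun i => a i₀ < a i
  have hHQ : H ⊆ Q := by
    intro i hi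
    by_contra hiQ
    exact absurd (hQmax i₀ hi₀ i hiQ) (not_le.2 (by simpa [H] using hi))
  have hHcard : H.card < n₁ := by
    rw [← hQ]
    exact Finset.card_lt_card ⟨hHQ, fun h => by simpa [H] using h hi₀⟩
  obtain ⟨R, hR, hRneg, hRH⟩ := exists_symmetric_superset hn₁ a (H := H)
    (fun i hi => by simpa [H, ha] using hi) hHcard
  refine ⟨Q, R, hQ, hR, hRneg, ?_⟩
  set w₁ := min m₁ (2 * n₁ - 1) with hw₁
  set w₂ := min m₂ (2 * n₂ - 1) with hw₂
  obtain ⟨t₁, ht₁⟩ := Nat.exists_eq_add_of_le (min_le_left m₁ (2 * n₁ - 1))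
  obtain ⟨t₂, ht₂⟩ := Nat.exists_eq_add_of_le (min_le_left m₂ (2 * n₂ - 1))
  rw [← hw₁] at ht₁
  rw [← hw₂] at ht₂
  have hnw₁ : n₁ ≤ w₁ := le_min hnm₁ (by omega)
  have hnw₂ : n₂ ≤ w₂ := le_min hnm₂ (by omega)
  -- The size hypothesis enters here: the right side is `m₁ * m₂ - w₁ * w₂`.
  have hmain : 2 * n₁ * n₂ ≤ w₁ * t₂ + t₁ * m₂ := by
    have h1 : w₁ * w₂ ≤ (2 * n₁ - 1) * (2 * n₂ - 1) :=
      Nat.mul_le_mul (min_le_right _ _) (min_le_right _ _)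
    have h2 : m₁ * m₂ = w₁ * w₂ + (w₁ * t₂ + t₁ * m₂) := by
      rw [ht₁, ht₂]
      ring
    omega
  -- Layer-cake argument: the claim is proved on each sublevel set of `a` and summed over `l < n₂`.
  have hlevel (l : ℕ) : 2 * n₂ * (Q.filter fun i => a i ≤ l).card ≤
      ∑ i, if a i ≤ l then (if i ∈ R then t₂ else m₂) else 0 := by
    set L := Finset.univ.filter fun i => l < a i with hL
    by_cases hl : ∃ i ∈ Q, a i ≤ l
    swap
    · push Not at hl
      rw [Finset.filter_eq_empty_iff.2 fun i hi => not_le.2 (hl i hi)]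
      simp
    obtain ⟨i₁, hi₁, hi₁l⟩ := hl
    have hLH : L ⊆ H := by
      intro i hi
      simp only [hL, H, Finset.mem_filter, Finset.mem_univ, true_and] at hi ⊢
      exact (hmin i₁ hi₁).trans_lt (hi₁l.trans_lt hi)
    have hQL : (Q.filter fun i => a i ≤ l).card = n₁ - L.card := by
      rw [← hQ, ← Finset.card_sdiff_of_subset (hLH.trans hHQ)]
      congr 1
      ext i
      simp [hL]
    have hsum : ∑ i, (if a i ≤ l then (if i ∈ R then t₂ else m₂) else 0) =
        (R \ L).card * t₂ + (Rᶜ \ L).card * m₂ := by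
      rw [← Finset.sum_filter, Finset.sum_ite, Finset.sum_const, Finset.sum_const, smul_eq_mul,
        smul_eq_mul]
      congr 3 <;>
      · ext i
        simp [hL, and_comm]
    have hc1 : (R \ L).card + L.card = w₁ + (L \ R).card := by
      rw [← hR]
      have h1 := Finset.card_sdiff_add_card_inter R L
      have h2 := Finset.card_sdiff_add_card_inter L R
      rw [Finset.inter_comm] at h2
      omega
    have hc2 : (Rᶜ \ L).card + (L \ R).card = t₁ := by
      have h1 := Finset.card_sdiff_add_card_inter Rᶜ L
      have h2 : Rᶜ ∩ L = L \ R := by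
        ext i
        simp [and_comm]
      rw [h2, Finset.card_compl, ZMod.card, hR] at h1
      omega
    -- A missed element is self-negative, and the self-negative element `k` of `R` has at least as
    -- large a value of `a`, hence also lies in `L`.
    have hd : (L \ R).card = 0 ∨ (L \ R).card = 1 ∧ 2 ≤ L.card ∧ 1 ≤ t₁ ∧ w₁ = 2 * n₁ - 1 := by
      rcases (L \ R).eq_empty_or_nonempty with h | ⟨i, hi⟩
      · exact Or.inl (by rw [h, Finset.card_empty])
      obtain ⟨hiL, hiR⟩ := Finset.mem_sdiff.1 hi
      obtain ⟨hi', k, hkR, hk, hik⟩ := hRH i (hLH hiL) hiR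
      have hkL : k ∈ L := by
        simp only [hL, Finset.mem_filter, Finset.mem_univ, true_and] at hiL ⊢
        omega
      have hki : k ≠ i := fun h => hiR (h ▸ hkR)
      have h1 : L \ R = {i} := by
        refine Finset.eq_singleton_iff_unique_mem.2 ⟨hi, fun j hj => ?_⟩
        obtain ⟨hjL, hjR⟩ := Finset.mem_sdiff.1 hj
        exact eq_of_eq_neg hk (hRH j (hLH hjL) hjR).1 hi' (fun h => hjR (h ▸ hkR)) hki
      have h2 : 1 < L.card := Finset.one_lt_card.2 ⟨k, hkL, i, hiL, hki⟩
      rw [h1, Finset.card_singleton] at hc2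
      refine Or.inr ⟨by rw [h1, Finset.card_singleton], h2, by omega, ?_⟩
      omega
    have := level_inequality (h := L.card) hnw₁ (by omega) (by omega) ht₂ hmain
      ((Finset.card_le_card hLH).trans_lt hHcard) hd
    rw [hQL, hsum]
    have e1 : (R \ L).card = w₁ + (L \ R).card - L.card := by omega
    have e2 : (Rᶜ \ L).card = t₁ - (L \ R).card := by omega
    rwa [e1, e2]
  have hlayer (x : ℕ) : n₂ - x = ∑ l ∈ Finset.range n₂, if x ≤ l then 1 else 0 := by
    rw [← Finset.sum_filter, ← Finset.card_eq_sum_ones]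
    have : (Finset.range n₂).filter (x ≤ ·) = Finset.Ico x n₂ := by
      ext l
      simp [and_comm]
    rw [this, Nat.card_Ico]
  -- The levels sum to `n₂ - a i` times a weight. On `R`, if `a i < n₂ ≤ w₂`, the minimum is `t₂`;
  -- off `R`, `(n₂ - a i) * m₂ ≤ n₂ * (m₂ - a i)` because `n₂ ≤ m₂`.
  have hpoint (i : ZMod m₁) :
      ∑ l ∈ Finset.range n₂, (if a i ≤ l then (if i ∈ R then t₂ else m₂) else 0) ≤
        n₂ * if i ∈ R then min (m₂ - w₂) (m₂ - a i) else m₂ - a i := by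
    have h1 : ∑ l ∈ Finset.range n₂, (if a i ≤ l then (if i ∈ R then t₂ else m₂) else 0) =
        (n₂ - a i) * if i ∈ R then t₂ else m₂ := by
      rw [hlayer, Finset.sum_mul]
      exact Finset.sum_congr rfl fun l _ => by split_ifs <;> simp
    rw [h1]
    rcases le_or_gt n₂ (a i) with h | h
    · rw [Nat.sub_eq_zero_of_le h, zero_mul]
      exact Nat.zero_le _
    split_ifs
    · rw [min_eq_left (by omega), ht₂, Nat.add_sub_cancel_left]
      exact Nat.mul_le_mul_right _ (Nat.sub_le _ _)
    · obtain ⟨c, hc⟩ := Nat.exists_eq_add_of_le (ham i)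
      obtain ⟨d, hd⟩ := Nat.exists_eq_add_of_lt h
      have e1 : n₂ - a i = d + 1 := by omega
      have e2 : m₂ - a i = c := by omega
      rw [e1, e2, hc, hd]
      have : d + 1 ≤ c := by omega
      nlinarith [Nat.mul_le_mul_left (a i) this]
  refine Nat.le_of_mul_le_mul_left ?_ hn₂
  calc n₂ * (2 * ∑ i ∈ Q, (n₂ - a i))
      = ∑ l ∈ Finset.range n₂, 2 * n₂ * (Q.filter fun i => a i ≤ l).card := by
        rw [← Finset.mul_sum, ← mul_assoc, mul_comm n₂ 2]
        congr 1
        simp_rw [hlayer, Finset.card_filter]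
        exact Finset.sum_comm
    _ ≤ ∑ l ∈ Finset.range n₂, ∑ i, (if a i ≤ l then (if i ∈ R then t₂ else m₂) else 0) :=
        Finset.sum_le_sum fun l _ => hlevel l
    _ = ∑ i, ∑ l ∈ Finset.range n₂, (if a i ≤ l then (if i ∈ R then t₂ else m₂) else 0) :=
        Finset.sum_comm
    _ ≤ _ := by
        rw [Finset.mul_sum]
        exact Finset.sum_le_sum fun i _ => hpoint i

end Selection

/-! ### Interpolation on the grid and the choice of frequencies. -/

section TwoDimensional

variable {m₁ m₂ : ℕ} {F : Type*} [Field F]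

/-- The additive character of the grid with frequency `ξ`. -/
def gridChar (ψ₁ : AddChar (ZMod m₁) F) (ψ₂ : AddChar (ZMod m₂) F) (ξ s : Grid m₁ m₂) : F :=
  ψ₁ (ξ.1 * s.1) * ψ₂ (ξ.2 * s.2)

lemma gridChar_add (ψ₁ : AddChar (ZMod m₁) F) (ψ₂ : AddChar (ZMod m₂) F) (ξ s t : Grid m₁ m₂) :
    gridChar ψ₁ ψ₂ ξ (s + t) = gridChar ψ₁ ψ₂ ξ s * gridChar ψ₁ ψ₂ ξ t := by
  simp only [gridChar, Prod.fst_add, Prod.snd_add, mul_add, AddChar.map_add_eq_mul]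
  ring

lemma gridChar_neg_left (ψ₁ : AddChar (ZMod m₁) F) (ψ₂ : AddChar (ZMod m₂) F)
    (ξ s : Grid m₁ m₂) : gridChar ψ₁ ψ₂ (-ξ) s = gridChar ψ₁ ψ₂ ξ (-s) := by
  simp [gridChar]

variable [NeZero m₁] [NeZero m₂] {ψ₁ : AddChar (ZMod m₁) F} {ψ₂ : AddChar (ZMod m₂) F}

lemma sum_mul_gridChar (b : Grid m₁ m₂ → F) (s : Grid m₁ m₂) :
    ∑ ξ, b ξ * gridChar ψ₁ ψ₂ ξ s =
      ∑ i, (∑ j, b (i, j) * ψ₂ (j * s.2)) * ψ₁ (i * s.1) := by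
  rw [Fintype.sum_prod_type]
  refine Finset.sum_congr rfl fun i _ => ?_
  rw [Finset.sum_mul]
  refine Finset.sum_congr rfl fun j _ => ?_
  simp only [gridChar]
  ring

/-- A trigonometric polynomial with spectrum in an `n₁ × n₂` window and with `n₂` zeros on each of
`n₁` rows vanishes. -/
lemma sample_eq_zero (hψ₁ : ψ₁.IsPrimitive) (hψ₂ : ψ₂.IsPrimitive) {n₁ n₂ : ℕ}
    {X : Fin n₁ × Fin n₂ → F} {Q : Finset (ZMod m₁)} (hQ : n₁ ≤ Q.card)
    {Z : ZMod m₁ → Finset (ZMod m₂)} (hZ : ∀ i ∈ Q, n₂ ≤ (Z i).card)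
    (h : ∀ i ∈ Q, ∀ j ∈ Z i, ∑ p, X p * gridChar ψ₁ ψ₂ (i, j)
      (((p.1 : ℕ) : ZMod m₁), ((p.2 : ℕ) : ZMod m₂)) = 0) : X = 0 := by
  have h1 (i) (hi : i ∈ Q) : (fun l : Fin n₂ => ∑ k : Fin n₁, X (k, l) * ψ₁ (i * (k : ℕ))) = 0 := by
    refine eq_zero_of_card_le_of_sum_fin_eq_zero hψ₂ (hZ i hi) fun j hj => ?_
    rw [← h i hi j hj, Fintype.sum_prod_type, Finset.sum_comm]
    refine Finset.sum_congr rfl fun l _ => ?_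
    rw [Finset.sum_mul]
    refine Finset.sum_congr rfl fun k _ => ?_
    simp only [gridChar]
    ring
  funext ⟨k, l⟩
  exact congrFun (eq_zero_of_card_le_of_sum_fin_eq_zero (x := fun k => X (k, l)) hψ₁ hQ
    fun i hi => congrFun (h1 i hi) l) k

/-- An even function on the dual grid whose transform is supported on the differences of the window
vanishes if it has enough zeros on `min m₁ (2 * n₁ - 1)` rows. -/
lemma even_eq_zero (hψ₁ : ψ₁.IsPrimitive) (hψ₂ : ψ₂.IsPrimitive) (hm₁ : (m₁ : F) ≠ 0)
    (hm₂ : (m₂ : F) ≠ 0) (h2 : (2 : F) ≠ 0) {n₁ n₂ : ℕ} (hn₁ : 1 ≤ n₁) (hn₂ : 1 ≤ n₂)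
    {b : Grid m₁ m₂ → F} (heven : ∀ ξ, b (-ξ) = b ξ)
    (hb : ∀ s : Grid m₁ m₂, s.1 ∉ windowDiff n₁ m₁ ∨ s.2 ∉ windowDiff n₂ m₂ →
      ∑ ξ, b ξ * gridChar ψ₁ ψ₂ ξ s = 0)
    {R : Finset (ZMod m₁)} (hR : min m₁ (2 * n₁ - 1) ≤ R.card) (hRneg : ∀ i ∈ R, -i ∈ R)
    {Z : ZMod m₁ → Finset (ZMod m₂)} (hZ : ∀ i, ∀ j ∈ Z i, b (i, j) = 0)
    (hZpair : ∀ i ∈ R, i ∈ pairReps m₁ → min m₂ (2 * n₂ - 1) ≤ (Z i).card)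
    (hZself : ∀ i ∈ R, i = -i → Z i ⊆ halfReps m₂ ∧ min n₂ (halfReps m₂).card ≤ (Z i).card) :
    b = 0 := by
  -- For fixed `s` outside the differences the double transform vanishes at every first coordinate,
  -- so inversion in that coordinate kills each row transform at `s`.
  have hrow (i : ZMod m₁) (s : ZMod m₂) (hs : s ∉ windowDiff n₂ m₂) :
      ∑ j, b (i, j) * ψ₂ (j * s) = 0 := by
    refine congrFun (eq_zero_of_forall_sum_addChar_eq_zero
      (β := fun i => ∑ j, b (i, j) * ψ₂ (j * s)) hψ₁ hm₁ fun s₁ => ?_) i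
    rw [← sum_mul_gridChar b (s₁, s)]
    exact hb _ (Or.inr hs)
  have hpair (i) (hi : i ∈ R) (hi' : i ∈ pairReps m₁) : (fun j => b (i, j)) = 0 :=
    eq_zero_of_support_subset_windowDiff hψ₂ hm₂ hn₂ (hrow i) (hZpair i hi hi') (hZ i)
  have hR0 (i) (hi : i ∈ R) (j : ZMod m₂) : b (i, j) = 0 := by
    rcases trichotomy_neg i with h | h | h
    · refine congrFun (eq_zero_of_even_of_support_subset_windowDiff (β := fun j => b (i, j)) hψ₂ hm₂
        h2 (fun j => ?_) (hrow i) (hZself i hi h).1 (hZself i hi h).2 (hZ i)) j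
      rw [← heven (i, j), Prod.neg_mk, ← h]
    · exact congrFun (hpair i hi h) j
    · rw [← heven, Prod.neg_mk]
      exact congrFun (hpair (-i) (hRneg i hi) h) (-j)
  have hcol (s : ZMod m₂) : (fun i => ∑ j, b (i, j) * ψ₂ (j * s)) = 0 := by
    refine eq_zero_of_support_subset_windowDiff hψ₁ hm₁ hn₁ (fun s₁ hs₁ => ?_) hR fun i hi => ?_
    · rw [← sum_mul_gridChar b (s₁, s)]
      exact hb _ (Or.inl hs₁)
    · simp [hR0 i hi]
  funext ⟨i, j⟩
  exact congrFun (eq_zero_of_forall_sum_addChar_eq_zero (β := fun j => b (i, j)) hψ₂ hm₂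
    fun s => congrFun (hcol s) i) j

/-- A symmetric set of frequencies leaves room for enough further frequencies: the set `C`
completes `A` to a set determining a sample, while the cosines with frequencies in `D` are linearly
independent outside of the differences of the window. -/
lemma exists_frequencies (hψ₁ : ψ₁.IsPrimitive) (hψ₂ : ψ₂.IsPrimitive) (hm₁ : (m₁ : F) ≠ 0)
    (hm₂ : (m₂ : F) ≠ 0) (h2 : (2 : F) ≠ 0) {n₁ n₂ : ℕ} (hn₁ : 1 ≤ n₁) (hn₂ : 1 ≤ n₂)
    (hnm₁ : n₁ ≤ m₁) (hnm₂ : n₂ ≤ m₂)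
    (hm : 2 * n₁ * n₂ + (2 * n₁ - 1) * (2 * n₂ - 1) ≤ m₁ * m₂)
    {A : Finset (Grid m₁ m₂)} (hA : ∀ ξ ∈ A, -ξ ∈ A) :
    ∃ C D : Finset (Grid m₁ m₂), C.card ≤ D.card ∧ Disjoint D A ∧
      (∀ ξ ∈ D, -ξ ∈ D → ξ = -ξ) ∧
      (∀ X : Fin n₁ × Fin n₂ → F, (∀ ξ ∈ A ∪ C, ∑ p, X p * gridChar ψ₁ ψ₂ ξ
        (((p.1 : ℕ) : ZMod m₁), ((p.2 : ℕ) : ZMod m₂)) = 0) → X = 0) ∧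
      ∀ b : Grid m₁ m₂ → F, (∀ ξ, b (-ξ) = b ξ) → (∀ ξ, ξ ∉ D → -ξ ∉ D → b ξ = 0) →
        (∀ s : Grid m₁ m₂, s.1 ∉ windowDiff n₁ m₁ ∨ s.2 ∉ windowDiff n₂ m₂ →
          ∑ ξ, b ξ * gridChar ψ₁ ψ₂ ξ s = 0) → b = 0 := by
  classical
  let Ar : ZMod m₁ → Finset (ZMod m₂) := fun i => Finset.univ.filter fun j => (i, j) ∈ A
  have hAr (i j) : j ∈ Ar i ↔ (i, j) ∈ A := by simp [Ar]
  have hArneg (i j) : -j ∈ Ar (-i) ↔ j ∈ Ar i := by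
    rw [hAr, hAr]
    exact ⟨fun h => by simpa using hA _ h, fun h => hA _ h⟩
  have hacard (i) : (Ar (-i)).card = (Ar i).card := by
    rw [← Finset.card_map (Equiv.neg (ZMod m₂)).toEmbedding]
    congr 1
    ext j
    rw [Finset.mem_map_equiv, Equiv.neg_symm, Equiv.neg_apply]
    rw [← hArneg (-i), neg_neg, neg_neg]
  have hale (i) : (Ar i).card ≤ m₂ := by simpa [ZMod.card] using Finset.card_le_univ (Ar i)
  obtain ⟨Q, R, hQ, hR, hRneg, hsum⟩ := exists_rows hn₁ hn₂ hnm₁ hnm₂ hm (fun i => (Ar i).card)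
    hacard hale
  have hcompl (i) : (Ar i)ᶜ.card = m₂ - (Ar i).card := by rw [Finset.card_compl, ZMod.card]
  have hC (i) : ∃ Ci ⊆ (Ar i)ᶜ, Ci.card = n₂ - (Ar i).card :=
    Finset.exists_subset_card_eq (by rw [hcompl]; omega)
  choose Cr hCr hCrcard using hC
  set t := m₂ - min m₂ (2 * n₂ - 1) with ht
  set c : ZMod m₁ → ℕ := fun i =>
    if i ∈ R then min t (m₂ - (Ar i).card) else m₂ - (Ar i).card with hc
  have hP (i) : ∃ Pi ⊆ (Ar i)ᶜ, Pi.card = c i := by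
    refine Finset.exists_subset_card_eq ?_
    rw [hcompl]
    simp only [hc]
    split_ifs
    · exact min_le_right _ _
    · exact le_rfl
  choose Pr hPr hPrcard using hP
  set e := min n₂ (halfReps m₂).card with he
  have hS (i) : ∃ Si ⊆ (Ar i)ᶜ ∩ halfReps m₂, Si.card =
      if i ∈ R then min ((halfReps m₂).card - e) ((Ar i)ᶜ ∩ halfReps m₂).card
      else ((Ar i)ᶜ ∩ halfReps m₂).card := by
    refine Finset.exists_subset_card_eq ?_
    split_ifs
    · exact min_le_right _ _
    · exact le_rfl
  choose Sr hSr hSrcard using hS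
  -- One representative per orbit of negation, since `ξ` and `-ξ` give the same cosine: one row of
  -- each pair, and half of a self-negative row.
  let Dr : ZMod m₁ → Finset (ZMod m₂) := fun i =>
    if i = -i then Sr i else if i ∈ pairReps m₁ then Pr i else ∅
  have hDself {i} (h : i = -i) : Dr i = Sr i := if_pos h
  have hDpair {i} (h : i ∈ pairReps m₁) : Dr i = Pr i := by
    simp only [Dr]
    rw [if_neg (mem_pairReps.1 h).2, if_pos h]
  have hDneg {i} (h : i ∈ pairReps m₁) : Dr (-i) = ∅ := by
    simp only [Dr]
    rw [if_neg (fun h' => (mem_pairReps.1 h).2 (by rwa [neg_neg, eq_comm] at h')),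
      if_neg (neg_notMem_pairReps h)]
  have hcneg (i) : c (-i) = c i := by
    have : -i ∈ R ↔ i ∈ R := ⟨fun h => by simpa using hRneg _ h, hRneg i⟩
    simp only [hc, this, hacard]
  -- Summed over `i` this gives `∑ c ≤ 2 |D|`, matching the factor `2` in `exists_rows`. In a
  -- self-negative row the complement of `A` is symmetric, so its half system contains at least half
  -- of it.
  have hcle (i) : c i ≤ (Dr i).card + (Dr (-i)).card := by
    rcases trichotomy_neg i with h | h | h
    · rw [← h, hDself h, hSrcard]
      have hhalf : (Ar i)ᶜ.card ≤ 2 * ((Ar i)ᶜ ∩ halfReps m₂).card := by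
        have hsub : (Ar i)ᶜ ⊆ ((Ar i)ᶜ ∩ halfReps m₂) ∪
            ((Ar i)ᶜ ∩ halfReps m₂).map (Equiv.neg (ZMod m₂)).toEmbedding := by
          intro j hj
          rw [Finset.mem_union, Finset.mem_map_equiv, Equiv.neg_symm, Equiv.neg_apply]
          have hj' : -j ∈ (Ar i)ᶜ := by
            rw [Finset.mem_compl] at hj ⊢
            rwa [h, hArneg]
          exact (mem_halfReps_or_neg_mem j).imp (fun h => Finset.mem_inter.2 ⟨hj, h⟩)
            fun h => Finset.mem_inter.2 ⟨hj', h⟩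
        have h1 := (Finset.card_le_card hsub).trans (Finset.card_union_le _ _)
        rw [Finset.card_map] at h1
        omega
      rw [hcompl] at hhalf
      have ht' : t ≤ 2 * ((halfReps m₂).card - e) := by
        rw [ht, he, card_halfReps]
        omega
      simp only [hc]
      split_ifs <;> omega
    · rw [hDpair h, hPrcard]
      exact Nat.le_add_right _ _
    · rw [hDpair h, hPrcard, hcneg]
      exact Nat.le_add_left _ _
  let C : Finset (Grid m₁ m₂) := Finset.univ.filter fun ξ => ξ.1 ∈ Q ∧ ξ.2 ∈ Cr ξ.1
  let D : Finset (Grid m₁ m₂) := Finset.univ.filter fun ξ => ξ.2 ∈ Dr ξ.1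
  have hD (i j) : (i, j) ∈ D ↔ j ∈ Dr i := by simp [D]
  have hCcard : C.card = ∑ i ∈ Q, (n₂ - (Ar i).card) := by
    have : C = (Q.sigma Cr).map (Equiv.sigmaEquivProd _ _).toEmbedding := by
      ext ⟨i, j⟩
      simp [C, Finset.mem_map_equiv]
    rw [this, Finset.card_map, Finset.card_sigma]
    exact Finset.sum_congr rfl fun i _ => hCrcard i
  have hDcard : D.card = ∑ i, (Dr i).card := by
    have : D = (Finset.univ.sigma Dr).map (Equiv.sigmaEquivProd _ _).toEmbedding := by
      ext ⟨i, j⟩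
      simp [D, Finset.mem_map_equiv]
    rw [this, Finset.card_map, Finset.card_sigma]
  refine ⟨C, D, ?_, ?_, ?_, ?_, ?_⟩
  · have h1 : ∑ i, c i ≤ ∑ i, ((Dr i).card + (Dr (-i)).card) :=
      Finset.sum_le_sum fun i _ => hcle i
    have h2 : ∑ i, (Dr (-i)).card = ∑ i, (Dr i).card :=
      Equiv.sum_comp (Equiv.neg (ZMod m₁)) fun i => (Dr i).card
    rw [Finset.sum_add_distrib, h2, ← hDcard] at h1
    rw [← hCcard] at hsum
    have := hsum.trans h1
    omega
  · rw [Finset.disjoint_left]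
    rintro ⟨i, j⟩ hj hjA
    rw [hD] at hj
    rw [← hAr] at hjA
    simp only [Dr] at hj
    split_ifs at hj
    · exact Finset.mem_compl.1 (Finset.mem_inter.1 (hSr i hj)).1 hjA
    · exact Finset.mem_compl.1 (hPr i hj) hjA
    · simp at hj
  · rintro ⟨i, j⟩ hj hj'
    rw [Prod.neg_mk, hD] at hj'
    rw [hD] at hj
    rcases trichotomy_neg i with h | h | h
    · rw [← h, hDself h] at hj'
      rw [hDself h] at hj
      have := eq_of_mem_halfReps (Finset.mem_inter.1 (hSr i hj)).2
        (Finset.mem_inter.1 (hSr i hj')).2 (neg_neg j).symm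
      rw [Prod.neg_mk, ← h, ← this]
    · rw [hDneg h] at hj'
      simp at hj'
    · have := hDneg h
      rw [neg_neg] at this
      rw [this] at hj
      simp at hj
  · intro X hX
    refine sample_eq_zero hψ₁ hψ₂ hQ.ge (Z := fun i => Ar i ∪ Cr i) (fun i _ => ?_)
      fun i hi j hj => ?_
    · rw [Finset.card_union_of_disjoint (Finset.disjoint_left.2 fun j hj hj' =>
        Finset.mem_compl.1 (hCr i hj') hj), hCrcard]
      omega
    · refine hX _ (Finset.mem_union.2 ((Finset.mem_union.1 hj).imp (hAr i j).1 fun h => ?_))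
      simp [C, hi, h]
  · intro b heven hbD hb
    refine even_eq_zero hψ₁ hψ₂ hm₁ hm₂ h2 hn₁ hn₂ heven hb hR.ge hRneg
      -- The quotas `c i` and the sizes of `Sr i` were capped on `R` precisely to leave enough zeros
      -- here.
      (Z := fun i => if i = -i then halfReps m₂ \ Sr i else if i ∈ pairReps m₁ then (Pr i)ᶜ else ∅)
      (fun i j hj => ?_) (fun i hi h => ?_) fun i hi h => ?_
    · split_ifs at hj with h h'
      · obtain ⟨hj1, hj2⟩ := Finset.mem_sdiff.1 hj
        refine hbD _ ?_ ?_
        · rwa [hD, hDself h]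
        · rw [Prod.neg_mk, hD, ← h, hDself h]
          intro hj'
          exact hj2 (eq_of_mem_halfReps hj1 (Finset.mem_inter.1 (hSr i hj')).2
            (neg_neg j).symm ▸ hj')
      · refine hbD _ ?_ ?_
        · rw [hD, hDpair h']
          exact Finset.mem_compl.1 hj
        · rw [Prod.neg_mk, hD, hDneg h']
          simp
      · simp at hj
    · rw [if_neg (mem_pairReps.1 h).2, if_pos h, Finset.card_compl, ZMod.card, hPrcard]
      simp only [hc]
      rw [if_pos hi]
      have : min m₂ (2 * n₂ - 1) ≤ m₂ := min_le_left _ _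
      omega
    · rw [if_pos h]
      refine ⟨Finset.sdiff_subset, ?_⟩
      rw [Finset.card_sdiff_of_subset ((hSr i).trans Finset.inter_subset_right), hSrcard, if_pos hi]
      omega

end TwoDimensional

lemma mem_linearShifts_of_notMem_windowDiff {n₁ n₂ m₁ m₂ : ℕ} (o : Grid m₁ m₂) {s : Grid m₁ m₂}
    (hs : s.1 ∉ windowDiff n₁ m₁ ∨ s.2 ∉ windowDiff n₂ m₂) : s ∈ linearShifts n₁ n₂ o := by
  intro p p' h
  simp only [pos, add_assoc] at h
  have h' := add_left_cancel h
  rcases hs with hs | hs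
  · exact hs ⟨p.1, p'.1, congrArg Prod.fst h'⟩
  · exact hs ⟨p.2, p'.2, congrArg Prod.snd h'⟩

/-! ### Counting annihilated pairs over a finite field. -/

section Counting

variable {n₁ n₂ m₁ m₂ : ℕ} {F : Type*} [Field F]

/-- The transform of a sample. -/
def sampleTransform (ψ₁ : AddChar (ZMod m₁) F) (ψ₂ : AddChar (ZMod m₂) F) (ξ : Grid m₁ m₂) :
    (Fin n₁ × Fin n₂ → F) →ₗ[F] F where
  toFun X := ∑ p, X p * gridChar ψ₁ ψ₂ ξ (((p.1 : ℕ) : ZMod m₁), ((p.2 : ℕ) : ZMod m₂))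
  map_add' X X' := by simp [add_mul, Finset.sum_add_distrib]
  map_smul' c X := by simp [Finset.mul_sum, mul_assoc]

lemma sampleTransform_apply (ψ₁ : AddChar (ZMod m₁) F) (ψ₂ : AddChar (ZMod m₂) F)
    (ξ : Grid m₁ m₂) (X : Fin n₁ × Fin n₂ → F) : sampleTransform ψ₁ ψ₂ ξ X =
      ∑ p, X p * gridChar ψ₁ ψ₂ ξ (((p.1 : ℕ) : ZMod m₁), ((p.2 : ℕ) : ZMod m₂)) :=
  rfl

/-- Twice the cosine with frequency `ξ`, restricted to the linear shifts. -/
def cosine (n₁ n₂ : ℕ) (o : Grid m₁ m₂) (ψ₁ : AddChar (ZMod m₁) F) (ψ₂ : AddChar (ZMod m₂) F)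
    (ξ : Grid m₁ m₂) (s : linearShifts n₁ n₂ o) : F :=
  gridChar ψ₁ ψ₂ ξ s + gridChar ψ₁ ψ₂ ξ (-s)

lemma cosine_neg (o : Grid m₁ m₂) (ψ₁ : AddChar (ZMod m₁) F) (ψ₂ : AddChar (ZMod m₂) F)
    (ξ : Grid m₁ m₂) : cosine n₁ n₂ o ψ₁ ψ₂ (-ξ) = cosine n₁ n₂ o ψ₁ ψ₂ ξ := by
  funext s
  simp only [cosine, gridChar_neg_left, neg_neg]
  rw [add_comm]

variable [NeZero m₁] [NeZero m₂]

/-- The linear part of the auto-correlation as a function of the spectrum of the background. -/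
def spectralMap (o : Grid m₁ m₂) (ψ₁ : AddChar (ZMod m₁) F) (ψ₂ : AddChar (ZMod m₂) F)
    (X : Fin n₁ × Fin n₂ → F) : (Grid m₁ m₂ → F) →ₗ[F] (linearShifts n₁ n₂ o → F) where
  toFun y := ∑ ξ, (y ξ * sampleTransform ψ₁ ψ₂ ξ X) • cosine n₁ n₂ o ψ₁ ψ₂ ξ
  map_add' y y' := by simp [add_mul, add_smul, Finset.sum_add_distrib]
  map_smul' c y := by simp [Finset.smul_sum, smul_smul, mul_assoc]

lemma spectralMap_apply (o : Grid m₁ m₂) (ψ₁ : AddChar (ZMod m₁) F) (ψ₂ : AddChar (ZMod m₂) F)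
    (X : Fin n₁ × Fin n₂ → F) (y : Grid m₁ m₂ → F) : spectralMap o ψ₁ ψ₂ X y =
      ∑ ξ, (y ξ * sampleTransform ψ₁ ψ₂ ξ X) • cosine n₁ n₂ o ψ₁ ψ₂ ξ :=
  rfl

lemma spectralMap_smul (o : Grid m₁ m₂) (ψ₁ : AddChar (ZMod m₁) F) (ψ₂ : AddChar (ZMod m₂) F)
    (c : F) (X : Fin n₁ × Fin n₂ → F) (y : Grid m₁ m₂ → F) :
    spectralMap o ψ₁ ψ₂ (c • X) y = c • spectralMap o ψ₁ ψ₂ X y := by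
  simp only [spectralMap_apply, map_smul, smul_eq_mul, Finset.smul_sum, smul_smul]
  exact Finset.sum_congr rfl fun ξ _ => by rw [mul_left_comm]

lemma sum_sample_mul_background (o : Grid m₁ m₂) (ψ₁ : AddChar (ZMod m₁) F)
    (ψ₂ : AddChar (ZMod m₂) F) (X : Fin n₁ × Fin n₂ → F) (y Y : Grid m₁ m₂ → F)
    (hY : ∀ q, Y q = ∑ ξ, y ξ * gridChar ψ₁ ψ₂ ξ (q - o)) (s : linearShifts n₁ n₂ o) :
    ∑ p, (Y (pos o p + s) + Y (pos o p - s)) * X p = spectralMap o ψ₁ ψ₂ X y s := by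
  have h (p : Fin n₁ × Fin n₂) : Y (pos o p + s) + Y (pos o p - s) =
      ∑ ξ, y ξ * gridChar ψ₁ ψ₂ ξ (((p.1 : ℕ) : ZMod m₁), ((p.2 : ℕ) : ZMod m₂)) *
        cosine n₁ n₂ o ψ₁ ψ₂ ξ s := by
    rw [hY, hY, ← Finset.sum_add_distrib]
    refine Finset.sum_congr rfl fun ξ _ => ?_
    have e1 : pos o p + (s : Grid m₁ m₂) - o =
        (((p.1 : ℕ) : ZMod m₁), ((p.2 : ℕ) : ZMod m₂)) + s := by
      simp only [pos]
      abel
    have e2 : pos o p - (s : Grid m₁ m₂) - o =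
        (((p.1 : ℕ) : ZMod m₁), ((p.2 : ℕ) : ZMod m₂)) + -s := by
      simp only [pos]
      abel
    rw [e1, e2, gridChar_add, gridChar_add, cosine]
    ring
  simp only [h, spectralMap_apply, Finset.sum_apply, Pi.smul_apply, smul_eq_mul,
    sampleTransform_apply, Finset.sum_mul, Finset.mul_sum]
  rw [Finset.sum_comm]
  refine Finset.sum_congr rfl fun ξ _ => Finset.sum_congr rfl fun p _ => ?_
  ring

variable {ψ₁ : AddChar (ZMod m₁) F} {ψ₂ : AddChar (ZMod m₂) F}

/-- A relation with coefficients `β` on `D` is a vanishing transform of the even function `β ξ + β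
(-ξ)`, so `hinj` applies. By `hD` no two distinct coefficients are merged; a self-negative frequency
only gains a factor `2`. -/
lemma linearIndependent_cosine (h2 : (2 : F) ≠ 0) (o : Grid m₁ m₂) {D : Finset (Grid m₁ m₂)}
    (hD : ∀ ξ ∈ D, -ξ ∈ D → ξ = -ξ)
    (hinj : ∀ b : Grid m₁ m₂ → F, (∀ ξ, b (-ξ) = b ξ) → (∀ ξ, ξ ∉ D → -ξ ∉ D → b ξ = 0) →
        (∀ s : Grid m₁ m₂, s.1 ∉ windowDiff n₁ m₁ ∨ s.2 ∉ windowDiff n₂ m₂ →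
          ∑ ξ, b ξ * gridChar ψ₁ ψ₂ ξ s = 0) → b = 0) :
    LinearIndependent F fun δ : D => cosine n₁ n₂ o ψ₁ ψ₂ (δ : Grid m₁ m₂) := by
  classical
  rw [Fintype.linearIndependent_iff]
  intro g hg δ
  let β : Grid m₁ m₂ → F := fun ξ => if h : ξ ∈ D then g ⟨ξ, h⟩ else 0
  have hβ (ξ : D) : β ξ = g ξ := by simp [β]
  have hβ0 (ξ) (h : ξ ∉ D) : β ξ = 0 := by simp [β, h]
  have hsum : ∑ ξ, β ξ • cosine n₁ n₂ o ψ₁ ψ₂ ξ = 0 := by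
    rw [← hg, ← Finset.sum_subset (Finset.subset_univ D) fun ξ _ h => by rw [hβ0 ξ h, zero_smul],
      ← Finset.sum_coe_sort]
    exact Finset.sum_congr rfl fun ξ _ => by rw [hβ]
  have hb : (fun ξ => β ξ + β (-ξ)) = 0 := by
    refine hinj _ (fun ξ => by rw [neg_neg, add_comm]) (fun ξ h h' => by simp [hβ0 _ h, hβ0 _ h'])
      fun s hs => ?_
    have h1 := congrFun hsum ⟨s, mem_linearShifts_of_notMem_windowDiff o hs⟩
    simp only [Finset.sum_apply, Pi.smul_apply, smul_eq_mul, cosine, Pi.zero_apply, mul_add,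
      Finset.sum_add_distrib] at h1
    simp only [add_mul, Finset.sum_add_distrib]
    rw [← h1]
    congr 1
    rw [← Equiv.sum_comp (Equiv.neg (Grid m₁ m₂))]
    simp [gridChar_neg_left]
  have h1 := congrFun hb δ
  simp only [Pi.zero_apply] at h1
  by_cases h : -(δ : Grid m₁ m₂) ∈ D
  · rw [← hD _ δ.2 h, hβ, ← two_mul] at h1
    simpa [h2] using h1
  · rwa [hβ0 _ h, add_zero, hβ] at h1

/-- A spectrum concentrated at a frequency where the transform of `X` is nonzero produces the cosine
of that frequency; either sign will do. -/
lemma card_le_finrank_range_spectralMap (o : Grid m₁ m₂) {X : Fin n₁ × Fin n₂ → F}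
    {D : Finset (Grid m₁ m₂)}
    (hX : ∀ ξ ∈ D, sampleTransform ψ₁ ψ₂ ξ X ≠ 0 ∨ sampleTransform ψ₁ ψ₂ (-ξ) X ≠ 0)
    (hli : LinearIndependent F fun δ : D => cosine n₁ n₂ o ψ₁ ψ₂ (δ : Grid m₁ m₂)) :
    D.card ≤ Module.finrank F (LinearMap.range (spectralMap o ψ₁ ψ₂ X)) := by
  classical
  have hsingle (ξ) (h : sampleTransform ψ₁ ψ₂ ξ X ≠ 0) :
      cosine n₁ n₂ o ψ₁ ψ₂ ξ ∈ LinearMap.range (spectralMap o ψ₁ ψ₂ X) := by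
    refine ⟨Pi.single ξ (sampleTransform ψ₁ ψ₂ ξ X)⁻¹, ?_⟩
    rw [spectralMap_apply, Finset.sum_eq_single ξ]
    · rw [Pi.single_eq_same, inv_mul_cancel₀ h, one_smul]
    · intro η _ hη
      rw [Pi.single_eq_of_ne hη, zero_mul, zero_smul]
    · simp
  have hmem (δ : D) : cosine n₁ n₂ o ψ₁ ψ₂ (δ : Grid m₁ m₂) ∈
      LinearMap.range (spectralMap o ψ₁ ψ₂ X) := by
    rcases hX δ δ.2 with h | h
    · exact hsingle _ h
    · rw [← cosine_neg]
      exact hsingle _ h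
  have := LinearIndependent.fintype_card_le_finrank (R := F)
    (LinearIndependent.of_comp (v := fun δ : D => (⟨_, hmem δ⟩ :
      LinearMap.range (spectralMap o ψ₁ ψ₂ X))) (LinearMap.range _).subtype hli)
  simpa using this

variable [Fintype F]

/-- If the field is large, then some background makes the linear part of the auto-correlation
determine the sample. -/
lemma exists_spectrum_forall_spectralMap_ne_zero (hψ₁ : ψ₁.IsPrimitive) (hψ₂ : ψ₂.IsPrimitive)
    (hm₁ : (m₁ : F) ≠ 0) (hm₂ : (m₂ : F) ≠ 0) (h2 : (2 : F) ≠ 0) (hn₁ : 1 ≤ n₁) (hn₂ : 1 ≤ n₂)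
    (hnm₁ : n₁ ≤ m₁) (hnm₂ : n₂ ≤ m₂)
    (hm : 2 * n₁ * n₂ + (2 * n₁ - 1) * (2 * n₂ - 1) ≤ m₁ * m₂)
    (hF : 2 ^ (m₁ * m₂) + 1 < Fintype.card F) (o : Grid m₁ m₂) :
    ∃ y : Grid m₁ m₂ → F, ∀ X : Fin n₁ × Fin n₂ → F, spectralMap o ψ₁ ψ₂ X y = 0 → X = 0 := by
  classical
  by_contra! hcon
  choose X₀ hX₀ hX₀ne using hcon
  set q := Fintype.card F with hq
  set N := Fintype.card (Grid m₁ m₂) with hN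
  have hNm : N = m₁ * m₂ := by simp [hN, Fintype.card_prod, ZMod.card]
  let A : (Fin n₁ × Fin n₂ → F) → Finset (Grid m₁ m₂) := fun X => Finset.univ.filter fun ξ =>
    sampleTransform ψ₁ ψ₂ ξ X = 0 ∧ sampleTransform ψ₁ ψ₂ (-ξ) X = 0
  let kerCard : (Fin n₁ × Fin n₂ → F) → ℕ := fun X =>
    (Finset.univ.filter fun y => spectralMap o ψ₁ ψ₂ X y = 0).card
  have hkey (B : Finset (Grid m₁ m₂)) :
      ∑ X ∈ Finset.univ.filter fun X => A X = B, kerCard X ≤ q ^ N := by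
    by_cases hB : ∀ ξ ∈ B, -ξ ∈ B
    swap
    · rw [Finset.sum_eq_zero]
      · exact Nat.zero_le _
      · intro X hX
        refine absurd ?_ hB
        rw [← (Finset.mem_filter.1 hX).2]
        intro ξ hξ
        simp only [A, Finset.mem_filter, Finset.mem_univ, true_and, neg_neg] at hξ ⊢
        exact hξ.symm
    obtain ⟨C, D, hCD, hDB, hDneg, hC, hD⟩ :=
      exists_frequencies hψ₁ hψ₂ hm₁ hm₂ h2 hn₁ hn₂ hnm₁ hnm₂ hm hB
    have hker (X) (hX : X ∈ Finset.univ.filter fun X => A X = B) :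
        kerCard X ≤ q ^ (N - D.card) := by
      have h1 : kerCard X = q ^ Module.finrank F (LinearMap.ker (spectralMap o ψ₁ ψ₂ X)) := by
        simp only [kerCard]
        rw [hq, ← Module.card_eq_pow_finrank (K := F), ← Fintype.card_subtype]
        exact Fintype.card_congr (Equiv.refl _)
      have h3 := LinearMap.finrank_range_add_finrank_ker (spectralMap o ψ₁ ψ₂ X)
      rw [Module.finrank_pi] at h3
      have h4 := card_le_finrank_range_spectralMap (X := X) o (fun ξ hξ => ?_)
        (linearIndependent_cosine h2 o hDneg hD)
      · rw [h1]
        exact Nat.pow_le_pow_right Fintype.card_pos (by omega)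
      · by_contra! h
        refine Finset.disjoint_left.1 hDB hξ ?_
        rw [← (Finset.mem_filter.1 hX).2]
        simpa [A] using h
    -- All these samples have zero transform on `B`, so the values on `C` separate them.
    have hV : (Finset.univ.filter fun X : Fin n₁ × Fin n₂ → F => A X = B).card ≤ q ^ C.card := by
      have h1 : Set.InjOn (fun X : Fin n₁ × Fin n₂ → F => fun ξ : C => sampleTransform ψ₁ ψ₂ ξ.1 X)
          (Finset.univ.filter fun X : Fin n₁ × Fin n₂ → F => A X = B) := by
        intro X hX X' hX' hXX'
        simp only [Finset.coe_filter, Finset.mem_univ, true_and, Set.mem_ofPred_eq] at hX hX'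
        rw [← sub_eq_zero]
        refine hC _ fun ξ hξ => ?_
        rw [← sampleTransform_apply, map_sub, sub_eq_zero]
        rcases Finset.mem_union.1 hξ with h | h
        · have h3 := h
          rw [← hX] at h
          rw [← hX'] at h3
          rw [(Finset.mem_filter.1 h).2.1, (Finset.mem_filter.1 h3).2.1]
        · exact congrFun hXX' ⟨ξ, h⟩
      have h3 := Finset.card_le_card_of_injOn _ (fun _ _ => Finset.mem_coe.2 (Finset.mem_univ _)) h1
      simpa [hq] using h3
    calc ∑ X ∈ Finset.univ.filter fun X => A X = B, kerCard X
        ≤ (Finset.univ.filter fun X => A X = B).card • q ^ (N - D.card) :=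
          Finset.sum_le_card_nsmul _ _ _ hker
      _ ≤ q ^ C.card * q ^ (N - D.card) := Nat.mul_le_mul_right _ hV
      _ ≤ q ^ N := by
          rw [← pow_add]
          refine Nat.pow_le_pow_right Fintype.card_pos ?_
          have : D.card ≤ N := Finset.card_le_univ D
          omega
  have htotal : ∑ X, kerCard X ≤ 2 ^ N * q ^ N := by
    rw [← Finset.sum_fiberwise Finset.univ A kerCard]
    refine (Finset.sum_le_card_nsmul _ _ _ fun B _ => hkey B).trans ?_
    simp [hN]
  have hlow : (q - 1) * q ^ N ≤ ∑ X, kerCard X := by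
    have h1 : ∑ X, kerCard X = ∑ y : Grid m₁ m₂ → F,
        (Finset.univ.filter fun X : Fin n₁ × Fin n₂ → F => spectralMap o ψ₁ ψ₂ X y = 0).card := by
      simp only [kerCard, Finset.card_filter]
      exact Finset.sum_comm
    -- Every scalar multiple of `X₀ y` is annihilated by `y`.
    have h3 (y : Grid m₁ m₂ → F) : q - 1 ≤
        (Finset.univ.filter fun X : Fin n₁ × Fin n₂ → F => spectralMap o ψ₁ ψ₂ X y = 0).card := by
      have h4 : q ≤ (Finset.univ.filter fun X : Fin n₁ × Fin n₂ → F =>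
          spectralMap o ψ₁ ψ₂ X y = 0).card := by
        rw [hq, ← Finset.card_univ]
        refine Finset.card_le_card_of_injOn (fun c => c • X₀ y) (fun c _ => ?_) fun c _ c' _ h => ?_
        · simp [spectralMap_smul, hX₀]
        · exact smul_left_injective F (hX₀ne y) h
      omega
    rw [h1]
    have h5 := Finset.card_nsmul_le_sum Finset.univ _ (q - 1)
      fun (y : Grid m₁ m₂ → F) _ => h3 y
    simpa [hN, hq, mul_comm] using h5
  have h1 : (q - 1) * q ^ N ≤ 2 ^ N * q ^ N := hlow.trans htotal
  have h3 : q - 1 ≤ 2 ^ N := Nat.le_of_mul_le_mul_right h1 (pow_pos Fintype.card_pos N)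
  rw [hNm] at h3
  omega

end Counting

/-! ### Transfer from a prime field to the reals. -/

lemma exists_isPrimitiveRoot_zmod_of_dvd {p m : ℕ} [Fact p.Prime] (hm : m ∣ p - 1) :
    ∃ ζ : ZMod p, IsPrimitiveRoot ζ m := by
  obtain ⟨g, hg⟩ := IsCyclic.exists_ofOrder_eq_natCard (α := (ZMod p)ˣ)
  rw [Nat.card_eq_fintype_card, ZMod.card_units] at hg
  have hp : 0 < p - 1 := Nat.sub_pos_of_lt (Fact.out : p.Prime).one_lt
  obtain ⟨k, hk⟩ := hm
  have h : IsPrimitiveRoot g (p - 1) := hg ▸ IsPrimitiveRoot.orderOf g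
  exact ⟨_, IsPrimitiveRoot.coe_units_iff.2 (h.pow hp (hk.trans (mul_comm m k)))⟩

/-- The system matrix of some background has a left inverse up to a nonzero determinant. -/
lemma exists_det_mul_systemMatrix_ne_zero {n₁ n₂ m₁ m₂ : ℕ} [NeZero m₁] [NeZero m₂]
    (hn₁ : 1 ≤ n₁) (hn₂ : 1 ≤ n₂) (hnm₁ : n₁ ≤ m₁) (hnm₂ : n₂ ≤ m₂)
    (hm : 2 * n₁ * n₂ + (2 * n₁ - 1) * (2 * n₂ - 1) ≤ m₁ * m₂) (o : Grid m₁ m₂) :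
    ∃ (L : Matrix (Fin n₁ × Fin n₂) (linearShifts n₁ n₂ o) ℝ) (Y : Grid m₁ m₂ → ℝ),
      (L * systemMatrix (n₁ := n₁) (n₂ := n₂) o Y).det ≠ 0 := by
  classical
  have hmm : 0 < m₁ * m₂ := Nat.mul_pos (NeZero.pos m₁) (NeZero.pos m₂)
  -- The congruence supplies roots of unity of orders `m₁` and `m₂`; the size serves the counting
  -- and keeps `m₁`, `m₂` and `2` nonzero modulo `p`.
  obtain ⟨p, hp, hpgt, hpmod⟩ := Nat.exists_prime_gt_modEq_one (2 ^ (m₁ * m₂) + 1) hmm.ne'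
  have : Fact p.Prime := ⟨hp⟩
  have hdvd : m₁ * m₂ ∣ p - 1 := (Nat.modEq_iff_dvd' hp.one_lt.le).1 hpmod.symm
  obtain ⟨ζ₁, hζ₁⟩ := exists_isPrimitiveRoot_zmod_of_dvd ((Dvd.intro _ rfl).trans hdvd : m₁ ∣ p - 1)
  obtain ⟨ζ₂, hζ₂⟩ :=
    exists_isPrimitiveRoot_zmod_of_dvd ((Dvd.intro_left _ rfl).trans hdvd : m₂ ∣ p - 1)
  have hcast (k : ℕ) (hk : 0 < k) (hkp : k < p) : (k : ZMod p) ≠ 0 := by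
    rw [Ne, ZMod.natCast_eq_zero_iff]
    exact fun h => absurd (Nat.le_of_dvd hk h) (not_le.2 hkp)
  have hpow : m₁ * m₂ < 2 ^ (m₁ * m₂) := Nat.lt_two_pow_self
  have hle₁ : m₁ ≤ m₁ * m₂ := Nat.le_mul_of_pos_right _ (NeZero.pos m₂)
  have hle₂ : m₂ ≤ m₁ * m₂ := Nat.le_mul_of_pos_left _ (NeZero.pos m₁)
  set ψ₁ := AddChar.zmodChar m₁ ((IsPrimitiveRoot.iff_def ζ₁ m₁).mp hζ₁).left with hψ₁
  set ψ₂ := AddChar.zmodChar m₂ ((IsPrimitiveRoot.iff_def ζ₂ m₂).mp hζ₂).left with hψ₂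
  obtain ⟨y, hy⟩ := exists_spectrum_forall_spectralMap_ne_zero (n₁ := n₁) (n₂ := n₂) (ψ₁ := ψ₁)
    (ψ₂ := ψ₂) (AddChar.zmodChar_primitive_of_primitive_root m₁ hζ₁)
    (AddChar.zmodChar_primitive_of_primitive_root m₂ hζ₂) (hcast m₁ (NeZero.pos m₁) (by omega))
    (hcast m₂ (NeZero.pos m₂) (by omega)) (by exact_mod_cast hcast 2 two_pos (by omega)) hn₁ hn₂
    hnm₁ hnm₂ hm (by rwa [ZMod.card]) o
  let Yp : Grid m₁ m₂ → ZMod p := fun q => ∑ ξ, y ξ * gridChar ψ₁ ψ₂ ξ (q - o)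
  let Mp : Matrix (linearShifts n₁ n₂ o) (Fin n₁ × Fin n₂) (ZMod p) :=
    Matrix.of fun s p => Yp (pos o p + s) + Yp (pos o p - s)
  have hker : LinearMap.ker Mp.mulVecLin = ⊥ := by
    refine LinearMap.ker_eq_bot'.2 fun X hX => hy X ?_
    funext s
    rw [← sum_sample_mul_background o ψ₁ ψ₂ X y Yp (fun _ => rfl) s]
    exact congrFun hX s
  obtain ⟨g, hg⟩ := Mp.mulVecLin.exists_leftInverse_of_injective hker
  let Lp := LinearMap.toMatrix' g
  have hLp : Lp * Mp = 1 := by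
    have := congrArg LinearMap.toMatrix' hg
    rwa [LinearMap.toMatrix'_comp, LinearMap.toMatrix'_id, ← Matrix.toLin'_apply',
      LinearMap.toMatrix'_toLin'] at this
  choose lift hlift using ZMod.intCast_surjective (n := p)
  let Yz : Grid m₁ m₂ → ℤ := fun q => lift (Yp q)
  let Mz : Matrix (linearShifts n₁ n₂ o) (Fin n₁ × Fin n₂) ℤ :=
    Matrix.of fun s p => Yz (pos o p + s) + Yz (pos o p - s)
  let Lz := Lp.map lift
  have hMz : Mz.map (Int.castRingHom (ZMod p)) = Mp := by
    ext s p
    simp [Mz, Mp, Yz, hlift]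
  have hLz : Lz.map (Int.castRingHom (ZMod p)) = Lp := by
    ext s p
    simp [Lz, hlift]
  -- The integer lifts have determinant congruent to `1` modulo `p`, so it is nonzero in `ℤ` and
  -- hence in `ℝ`.
  have hdet : (Lz * Mz).det ≠ 0 := by
    intro h
    have h1 := congrArg (Int.castRingHom (ZMod p)) h
    rw [RingHom.map_det, RingHom.mapMatrix_apply, Matrix.map_mul, hMz, hLz, hLp] at h1
    simp at h1
  refine ⟨Lz.map (Int.castRingHom ℝ), fun q => Yz q, ?_⟩
  have hMr : systemMatrix o (fun q => (Yz q : ℝ)) = Mz.map (Int.castRingHom ℝ) := by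
    ext s p
    simp [systemMatrix, Mz]
  rw [hMr, ← Matrix.map_mul, ← RingHom.mapMatrix_apply, ← RingHom.map_det]
  simpa using hdet

/-! ### Generic nonvanishing of the determinant. -/

lemma systemMatrix_add {n₁ n₂ m₁ m₂ : ℕ} (o : Grid m₁ m₂) (Y Y' : Grid m₁ m₂ → ℝ) :
    systemMatrix (n₁ := n₁) (n₂ := n₂) o (Y + Y') = systemMatrix o Y + systemMatrix o Y' := by
  ext s p
  simp only [systemMatrix, Matrix.of_apply, Matrix.add_apply, Pi.add_apply]
  ring

lemma systemMatrix_smul {n₁ n₂ m₁ m₂ : ℕ} (o : Grid m₁ m₂) (c : ℝ) (Y : Grid m₁ m₂ → ℝ) :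
    systemMatrix (n₁ := n₁) (n₂ := n₂) o (c • Y) = c • systemMatrix o Y := by
  ext s p
  simp [systemMatrix, mul_add]

/-- The system matrix does not depend on the values of the background on the window. -/
lemma systemMatrix_congr {n₁ n₂ m₁ m₂ : ℕ} (o : Grid m₁ m₂) {Y Y' : Grid m₁ m₂ → ℝ}
    (h : ∀ q, q ∉ Set.range (pos (n₁ := n₁) (n₂ := n₂) o) → Y q = Y' q) :
    systemMatrix (n₁ := n₁) (n₂ := n₂) o Y = systemMatrix o Y' := by
  ext s p
  simp only [systemMatrix, Matrix.of_apply]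
  rw [h _ ?_, h _ ?_]
  · rintro ⟨p', hp'⟩
    refine s.2 p' p ?_
    rw [hp', sub_add_cancel]
  · rintro ⟨p', hp'⟩
    exact s.2 p p' hp'.symm

lemma isUnit_transpose_mul_self {ι κ : Type*} [Fintype ι] [Fintype κ] [DecidableEq κ]
    {L : Matrix κ ι ℝ} {M : Matrix ι κ ℝ} (h : (L * M).det ≠ 0) : IsUnit (Mᵀ * M) := by
  rw [Matrix.isUnit_iff_isUnit_det, isUnit_iff_ne_zero]
  intro h0
  obtain ⟨v, hv, hv0⟩ := Matrix.exists_mulVec_eq_zero_iff.2 h0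
  rw [← Matrix.conjTranspose_eq_transpose_of_trivial,
    Matrix.conjTranspose_mul_self_mulVec_eq_zero] at hv0
  refine h (Matrix.exists_mulVec_eq_zero_iff.1 ⟨v, hv, ?_⟩)
  rw [← Matrix.mulVec_mulVec, hv0, Matrix.mulVec_zero]

/-- Factoring out `B` turns the determinant into the characteristic polynomial of `-(B⁻¹ * A)`,
which is monic. -/
lemma finite_setOf_det_add_smul_eq_zero {κ : Type*} [Fintype κ] [DecidableEq κ]
    (A : Matrix κ κ ℝ) {B : Matrix κ κ ℝ} (hB : B.det ≠ 0) :
    {t : ℝ | (A + t • B).det = 0}.Finite := by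
  have hunit : IsUnit B.det := isUnit_iff_ne_zero.2 hB
  refine (Polynomial.finite_setOfPred_isRoot (-(B⁻¹ * A)).charpoly_monic.ne_zero).subset
    fun t ht => ?_
  have h1 : A + t • B = B * (Matrix.scalar κ t - -(B⁻¹ * A)) := by
    rw [sub_neg_eq_add, mul_add, ← mul_assoc, Matrix.mul_nonsing_inv _ hunit, one_mul, add_comm]
    congr 1
    rw [Matrix.scalar_apply, ← Matrix.smul_one_eq_diagonal, Matrix.mul_smul, mul_one]
  rw [Set.mem_ofPred_eq, h1, Matrix.det_mul] at ht
  change Polynomial.IsRoot _ _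
  rw [Polynomial.IsRoot, Matrix.eval_charpoly]
  exact (mul_eq_zero.1 ht).resolve_left hB

lemma pi_absolutelyContinuous_pi (μ ν : Measure ℝ) [SigmaFinite μ] [SigmaFinite ν] (h : μ ≪ ν)
    (ι : Type*) [Fintype ι] :
    Measure.pi (fun _ : ι => μ) ≪ Measure.pi (fun _ : ι => ν) := by
  refine Fintype.induction_empty_option
    (P := fun ι _ => Measure.pi (fun _ : ι => μ) ≪ Measure.pi (fun _ : ι => ν))
    (fun α β _ e ih => ?_) ?_ (fun α _ ih => ?_) ι
  · let _ := Fintype.ofEquiv β e.symm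
    have hμ := measurePreserving_arrowCongr' (fun _ => μ) (fun _ => μ) e (MeasurableEquiv.refl ℝ)
      fun _ => MeasurePreserving.id μ
    have hν := measurePreserving_arrowCongr' (fun _ => ν) (fun _ => ν) e (MeasurableEquiv.refl ℝ)
      fun _ => MeasurePreserving.id ν
    rw [← hμ.map_eq, ← hν.map_eq]
    exact ih.map hμ.measurable
  · rw [Measure.pi_of_empty, Measure.pi_of_empty]
  · rw [← Measure.pi_map_piOptionEquivProd, ← Measure.pi_map_piOptionEquivProd]
    exact (ih.prod h).map (MeasurableEquiv.measurable _)

/-! ### Almost sure injectivity for the random background. -/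

section Background

variable {n₁ n₂ m₁ m₂ : ℕ}

lemma continuous_systemMatrix (o : Grid m₁ m₂) :
    Continuous (systemMatrix o : (Grid m₁ m₂ → ℝ) → Matrix (linearShifts n₁ n₂ o) _ ℝ) :=
  continuous_matrix fun s p => by
    simp only [systemMatrix, Matrix.of_apply]
    fun_prop

/-- The extension by zero of a function on the complement of the window. -/
def extendByZero (n₁ n₂ : ℕ) (o : Grid m₁ m₂)
    (z : {q // q ∉ Set.range (pos (n₁ := n₁) (n₂ := n₂) o)} → ℝ) : Grid m₁ m₂ → ℝ :=
  open Classical in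
  fun q => if h : q ∈ Set.range (pos (n₁ := n₁) (n₂ := n₂) o) then 0 else z ⟨q, h⟩

lemma continuous_extendByZero (o : Grid m₁ m₂) : Continuous (extendByZero n₁ n₂ o) := by
  refine continuous_pi fun q => ?_
  unfold extendByZero
  split_ifs
  · fun_prop
  · fun_prop

lemma extendByZero_add_smul (o : Grid m₁ m₂)
    (z v : {q // q ∉ Set.range (pos (n₁ := n₁) (n₂ := n₂) o)} → ℝ) (t : ℝ) :
    extendByZero n₁ n₂ o (z + t • v) = extendByZero n₁ n₂ o z + t • extendByZero n₁ n₂ o v := by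
  funext q
  simp only [extendByZero, Pi.add_apply, Pi.smul_apply]
  split_ifs <;> simp

lemma extendByZero_restrict (o : Grid m₁ m₂) {y : Grid m₁ m₂ → ℝ}
    (hy : ∀ p : Fin n₁ × Fin n₂, y (pos o p) = 0) :
    extendByZero n₁ n₂ o (fun q => y q) = y := by
  funext q
  unfold extendByZero
  split_ifs with h
  · obtain ⟨p, rfl⟩ := h
    exact (hy p).symm
  · rfl

variable [NeZero m₁] [NeZero m₂]

/-- Almost every translate of the background has an injective system matrix. -/
lemma ae_det_mul_systemMatrix_ne_zero (o : Grid m₁ m₂)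
    {L : Matrix (Fin n₁ × Fin n₂) (linearShifts n₁ n₂ o) ℝ} {Y₀ : Grid m₁ m₂ → ℝ}
    (h₀ : (L * systemMatrix (n₁ := n₁) (n₂ := n₂) o Y₀).det ≠ 0) (e : Grid m₁ m₂ → ℝ) :
    ∀ᵐ z, (L * systemMatrix (n₁ := n₁) (n₂ := n₂) o (extendByZero n₁ n₂ o z + e)).det ≠ 0 := by
  classical
  -- Truncating `Y₀` to zero on the window leaves its system matrix unchanged, so `v` is an
  -- admissible direction.
  let v : {q // q ∉ Set.range (pos (n₁ := n₁) (n₂ := n₂) o)} → ℝ := fun q => Y₀ q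
  have hv : systemMatrix (n₁ := n₁) (n₂ := n₂) o (extendByZero n₁ n₂ o v) = systemMatrix o Y₀ :=
    systemMatrix_congr o fun q hq => by simp only [extendByZero, dif_neg hq, v]
  have hmeas : MeasurableSet {z |
      (L * systemMatrix (n₁ := n₁) (n₂ := n₂) o (extendByZero n₁ n₂ o z + e)).det ≠ 0} := by
    refine (isOpen_ne_fun ?_ continuous_const).measurableSet
    refine Continuous.matrix_det (continuous_const.matrix_mul ((continuous_systemMatrix o).comp ?_))
    exact (continuous_extendByZero o).add continuous_const
  have hline (z) : ∀ᵐ t : ℝ, z + LinearMap.toSpanSingleton ℝ _ v t ∈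
      {z | (L * systemMatrix (n₁ := n₁) (n₂ := n₂) o (extendByZero n₁ n₂ o z + e)).det ≠ 0} := by
    have hfin := finite_setOf_det_add_smul_eq_zero
      (L * systemMatrix (n₁ := n₁) (n₂ := n₂) o (extendByZero n₁ n₂ o z + e)) h₀
    filter_upwards [hfin.countable.ae_notMem volume] with t ht
    simp only [LinearMap.toSpanSingleton_apply] at ht ⊢
    rwa [extendByZero_add_smul, add_right_comm, systemMatrix_add, systemMatrix_smul, hv,
      Matrix.mul_add, Matrix.mul_smul]
  exact ae_mem_of_ae_add_linearMap_mem (LinearMap.toSpanSingleton ℝ _ v) volume volume hmeas hline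

/-- With probability one, the system matrix of the perturbed background is injective. -/
lemma ae_isUnit_transpose_mul_systemMatrix (hn₁ : 1 ≤ n₁) (hn₂ : 1 ≤ n₂) (hnm₁ : n₁ ≤ m₁)
    (hnm₂ : n₂ ≤ m₂) (hm : 2 * n₁ * n₂ + (2 * n₁ - 1) * (2 * n₂ - 1) ≤ m₁ * m₂)
    {Ω : Type*} [MeasurableSpace Ω] (P : Measure Ω) [IsProbabilityMeasure P] (o : Grid m₁ m₂)
    (μ : ℝ) {σ : ℝ≥0} (hσ : 0 < σ) (Y ε : Ω → Grid m₁ m₂ → ℝ)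
    (hY₀ : ∀ ω, ∀ p : Fin n₁ × Fin n₂, Y ω (pos o p) = 0)
    (hlaw : ∀ q, q ∉ Set.range (pos (n₁ := n₁) (n₂ := n₂) o) →
      HasLaw (fun ω => Y ω q) (gaussianReal μ (σ ^ 2)) P)
    (hind : iIndepFun
      (fun (q : {q // q ∉ Set.range (pos (n₁ := n₁) (n₂ := n₂) o)}) ω => Y ω q) P)
    (hε : Measurable ε) (hYε : IndepFun Y ε P) :
    ∀ᵐ ω ∂P, IsUnit ((systemMatrix (n₁ := n₁) (n₂ := n₂) o (Y ω + ε ω))ᵀ *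
      systemMatrix (n₁ := n₁) (n₂ := n₂) o (Y ω + ε ω)) := by
  classical
  obtain ⟨L, Y₀, h₀⟩ := exists_det_mul_systemMatrix_ne_zero hn₁ hn₂ hnm₁ hnm₂ hm o
  let Z : Ω → {q // q ∉ Set.range (pos (n₁ := n₁) (n₂ := n₂) o)} → ℝ := fun ω q => Y ω q
  have hZlaw : HasLaw Z (Measure.pi fun _ => gaussianReal μ (σ ^ 2)) P :=
    iIndepFun.hasLaw_pi (fun q => hlaw q q.2) hind
  have hZε : IndepFun ε Z P :=
    hYε.symm.comp measurable_id (ψ := fun (y : Grid m₁ m₂ → ℝ)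
      (q : {q // q ∉ Set.range (pos (n₁ := n₁) (n₂ := n₂) o)}) => y q.1)
      (measurable_pi_lambda _ fun q => measurable_pi_apply _)
  have hac : (Measure.pi fun _ => gaussianReal μ (σ ^ 2)) ≪
      (volume : Measure ({q // q ∉ Set.range (pos (n₁ := n₁) (n₂ := n₂) o)} → ℝ)) :=
    pi_absolutelyContinuous_pi _ _
      (gaussianReal_absolutelyContinuous μ (pow_ne_zero 2 hσ.ne')) _
  have hmap := (indepFun_iff_map_prod_eq_prod_map_map hε.aemeasurable hZlaw.aemeasurable).1 hZε
  rw [hZlaw.map_eq] at hmap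
  have hmeas : MeasurableSet {x : (Grid m₁ m₂ → ℝ) × _ |
      (L * systemMatrix (n₁ := n₁) (n₂ := n₂) o (extendByZero n₁ n₂ o x.2 + x.1)).det ≠ 0} := by
    refine (isOpen_ne_fun ?_ continuous_const).measurableSet
    refine Continuous.matrix_det (continuous_const.matrix_mul ((continuous_systemMatrix o).comp ?_))
    exact ((continuous_extendByZero o).comp continuous_snd).add continuous_fst
  -- By independence the joint law is a product, so the bias may be frozen.
  have hprod : ∀ᵐ x ∂(P.map fun ω => (ε ω, Z ω)),
      (L * systemMatrix (n₁ := n₁) (n₂ := n₂) o (extendByZero n₁ n₂ o x.2 + x.1)).det ≠ 0 := by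
    rw [hmap, Measure.ae_prod_iff_ae_ae hmeas]
    exact Filter.Eventually.of_forall fun e =>
      hac.ae_le (ae_det_mul_systemMatrix_ne_zero o h₀ e)
  filter_upwards [ae_of_ae_map (hε.aemeasurable.prodMk hZlaw.aemeasurable) hprod] with ω hω
  rw [extendByZero_restrict o (hY₀ ω)] at hω
  exact isUnit_transpose_mul_self hω

end Background

/-! ### Singular values and real least squares. -/

section SingularValue

open scoped InnerProductSpace in
lemma norm_apply_le_singularValues_zero_mul {E F : Type*} [NormedAddCommGroup E]
    [InnerProductSpace ℝ E] [FiniteDimensional ℝ E] [NormedAddCommGroup F] [InnerProductSpace ℝ F]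
    [FiniteDimensional ℝ F] (T : E →ₗ[ℝ] F) (x : E) : ‖T x‖ ≤ T.singularValues 0 * ‖x‖ := by
  have hS := T.isSymmetric_adjoint_comp_self
  set b := hS.eigenvectorBasis rfl with hb
  have hsum : ‖T x‖ ^ 2 = ∑ i, hS.eigenvalues rfl i * ⟪b i, x⟫_ℝ ^ 2 := by
    have h1 : ‖T x‖ ^ 2 = ⟪x, (T.adjoint ∘ₗ T) x⟫_ℝ := by
      rw [LinearMap.comp_apply, LinearMap.adjoint_inner_right, real_inner_self_eq_norm_sq]
    rw [h1, ← b.sum_inner_mul_inner]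
    refine Finset.sum_congr rfl fun i _ => ?_
    rw [← hS, hb, hS.apply_eigenvectorBasis, real_inner_smul_left, real_inner_comm x]
    simp only [RCLike.ofReal_real_eq_id, id]
    ring
  refine le_of_sq_le_sq ?_ (mul_nonneg (T.singularValues_nonneg 0) (norm_nonneg x))
  rw [hsum, mul_pow, ← b.sum_sq_norm_inner_right x, Finset.mul_sum]
  refine Finset.sum_le_sum fun i _ => ?_
  rw [Real.norm_eq_abs, sq_abs]
  refine mul_le_mul_of_nonneg_right ?_ (sq_nonneg _)
  rw [← T.sq_singularValues_fin rfl i]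
  exact pow_le_pow_left₀ (T.singularValues_nonneg _) (T.singularValues_antitone (Nat.zero_le _)) 2

variable {ι κ : Type*} [Fintype ι] [Fintype κ]

lemma maxSingularValue_nonneg [DecidableEq κ] (A : Matrix ι κ ℝ) : 0 ≤ maxSingularValue A :=
  LinearMap.singularValues_nonneg _ _

lemma norm_mulVec_le_maxSingularValue_mul [DecidableEq κ] (A : Matrix ι κ ℝ) (x : κ → ℝ) :
    ‖WithLp.toLp 2 (A *ᵥ x)‖ ≤ maxSingularValue A * ‖WithLp.toLp 2 x‖ := by
  have := norm_apply_le_singularValues_zero_mul (Matrix.toEuclideanLin A) (WithLp.toLp 2 x)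
  rwa [Matrix.toLpLin_toLp, Matrix.toLin'_apply] at this

lemma norm_toLp_sq (x : κ → ℝ) : ‖WithLp.toLp 2 x‖ ^ 2 = x ⬝ᵥ x := by
  rw [EuclideanSpace.real_norm_sq_eq]
  simp [dotProduct, sq]

/-- With `x = Aᵀy`, `‖x‖² = ⟨y, Ax⟩ ≤ ‖y‖ ‖Ax‖`; this avoids comparing the singular values of `A`
and `Aᵀ`. -/
lemma norm_transpose_mulVec_le_maxSingularValue_mul [DecidableEq κ] (A : Matrix ι κ ℝ)
    (y : ι → ℝ) : ‖WithLp.toLp 2 (Aᵀ *ᵥ y)‖ ≤ maxSingularValue A * ‖WithLp.toLp 2 y‖ := by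
  set x := Aᵀ *ᵥ y with hx
  have h1 : ‖WithLp.toLp 2 x‖ ^ 2 ≤ ‖WithLp.toLp 2 y‖ * ‖WithLp.toLp 2 (A *ᵥ x)‖ := by
    have h2 : x ⬝ᵥ x = y ⬝ᵥ A *ᵥ x := by
      rw [Matrix.dotProduct_mulVec y A x, ← Matrix.mulVec_transpose A y]
    have h3 := real_inner_le_norm (WithLp.toLp 2 (A *ᵥ x)) (WithLp.toLp 2 y)
    rw [EuclideanSpace.inner_toLp_toLp, star_trivial] at h3
    rw [norm_toLp_sq, h2, mul_comm]
    exact h3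
  rcases (norm_nonneg (WithLp.toLp 2 x)).eq_or_lt with h0 | h0
  · rw [← h0]
    exact mul_nonneg (maxSingularValue_nonneg A) (norm_nonneg _)
  · have h2 := norm_mulVec_le_maxSingularValue_mul A x
    refine le_of_mul_le_mul_right ?_ h0
    calc ‖WithLp.toLp 2 x‖ * ‖WithLp.toLp 2 x‖ = ‖WithLp.toLp 2 x‖ ^ 2 := (sq _).symm
      _ ≤ ‖WithLp.toLp 2 y‖ * ‖WithLp.toLp 2 (A *ᵥ x)‖ := h1
      _ ≤ ‖WithLp.toLp 2 y‖ * (maxSingularValue A * ‖WithLp.toLp 2 x‖) :=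
          mul_le_mul_of_nonneg_left h2 (norm_nonneg _)
      _ = _ := by ring

lemma frobNorm_eq_norm (A : Matrix ι κ ℝ) :
    frobNorm A = ‖WithLp.toLp 2 fun p : ι × κ => A p.1 p.2‖ := by
  rw [EuclideanSpace.norm_eq, frobNorm, Fintype.sum_prod_type]
  simp

/-- The solution of a real least squares problem with complex right-hand side. -/
lemma eq_of_isMinOn_sum_norm_sq [DecidableEq κ] {M : Matrix ι κ ℝ} (hM : IsUnit (Mᵀ * M))
    (R : ι → ℂ) {x : κ → ℝ}
    (hx : ∀ x', ∑ s, ‖(((M *ᵥ x) s : ℝ) : ℂ) - R s‖ ^ 2 ≤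
      ∑ s, ‖(((M *ᵥ x') s : ℝ) : ℂ) - R s‖ ^ 2) :
    x = (Mᵀ * M)⁻¹ *ᵥ (Mᵀ *ᵥ fun s => (R s).re) := by
  have hdet : IsUnit (Mᵀ * M).det := (Matrix.isUnit_iff_isUnit_det _).1 hM
  set r : ι → ℝ := fun s => (R s).re with hr
  set x₀ := (Mᵀ * M)⁻¹ *ᵥ (Mᵀ *ᵥ r) with hx₀
  have hnormal : Mᵀ *ᵥ (M *ᵥ x₀ - r) = 0 := by
    rw [Matrix.mulVec_sub, Matrix.mulVec_mulVec, hx₀, Matrix.mulVec_mulVec,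
      Matrix.mul_nonsing_inv _ hdet, Matrix.one_mulVec, sub_self]
  -- The imaginary part of `R` adds a constant, so only its real part matters.
  have hsplit (z : κ → ℝ) : ∑ s, ‖(((M *ᵥ z) s : ℝ) : ℂ) - R s‖ ^ 2 =
      (M *ᵥ z - r) ⬝ᵥ (M *ᵥ z - r) + ∑ s, (R s).im ^ 2 := by
    rw [dotProduct, ← Finset.sum_add_distrib]
    refine Finset.sum_congr rfl fun s _ => ?_
    rw [← Complex.normSq_eq_norm_sq, Complex.normSq_apply]
    simp [hr]
    ring
  have hpyth (z : κ → ℝ) : (M *ᵥ z - r) ⬝ᵥ (M *ᵥ z - r) =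
      (M *ᵥ (z - x₀)) ⬝ᵥ (M *ᵥ (z - x₀)) + (M *ᵥ x₀ - r) ⬝ᵥ (M *ᵥ x₀ - r) := by
    have h1 : M *ᵥ z - r = M *ᵥ (z - x₀) + (M *ᵥ x₀ - r) := by
      rw [Matrix.mulVec_sub]
      abel
    have h2 : (M *ᵥ x₀ - r) ⬝ᵥ (M *ᵥ (z - x₀)) = 0 := by
      rw [Matrix.dotProduct_mulVec, ← Matrix.mulVec_transpose, hnormal, zero_dotProduct]
    rw [h1, add_dotProduct, dotProduct_add, dotProduct_add, h2,
      dotProduct_comm _ (M *ᵥ x₀ - r), h2]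
    ring
  have h1 := hx x₀
  rw [hsplit, hsplit, hpyth x] at h1
  have h2 : (M *ᵥ (x - x₀)) ⬝ᵥ (M *ᵥ (x - x₀)) ≤ 0 := by linarith
  have h3 : M *ᵥ (x - x₀) = 0 := by
    rw [← dotProduct_self_eq_zero]
    refine le_antisymm h2 ?_
    rw [← norm_toLp_sq]
    positivity
  have h4 : (Mᵀ * M) *ᵥ (x - x₀) = 0 := by
    rw [← Matrix.mulVec_mulVec, h3, Matrix.mulVec_zero]
  have h5 := congrArg (fun v => (Mᵀ * M)⁻¹ *ᵥ v) h4
  simp only [Matrix.mulVec_mulVec, Matrix.nonsing_inv_mul _ hdet, Matrix.one_mulVec,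
    Matrix.mulVec_zero] at h5
  exact sub_eq_zero.1 h5

end SingularValue

/-! ### Auto-correlation and Parseval on the grid. -/

section Fourier

variable {m₁ m₂ : ℕ} [NeZero m₁] [NeZero m₂]

open ZMod in
lemma dft₂_eq (f : Grid m₁ m₂ → ℂ) (l : Grid m₁ m₂) :
    dft₂ f l = ∑ q, f q * gridChar stdAddChar stdAddChar l (-q) := by
  refine Finset.sum_congr rfl fun q _ => ?_
  simp only [gridChar, Prod.fst_neg, Prod.snd_neg, mul_comm l.1, mul_comm l.2, neg_mul]
  ring

open ZMod in
lemma invDft₂_eq (f : Grid m₁ m₂ → ℂ) (s : Grid m₁ m₂) :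
    invDft₂ f s = ((m₁ : ℂ) * m₂)⁻¹ * ∑ l, f l * gridChar stdAddChar stdAddChar l s := by
  rw [invDft₂]
  congr 1
  refine Finset.sum_congr rfl fun l _ => ?_
  simp only [gridChar]
  ring

open ZMod ComplexConjugate in
lemma conj_gridChar (l s : Grid m₁ m₂) :
    conj (gridChar stdAddChar stdAddChar l s : ℂ) = gridChar stdAddChar stdAddChar l (-s) := by
  simp only [gridChar, map_mul, ← AddChar.map_neg_eq_conj, Prod.fst_neg, Prod.snd_neg, mul_neg]

open ZMod in
lemma sum_gridChar (s : Grid m₁ m₂) :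
    ∑ l, (gridChar stdAddChar stdAddChar l s : ℂ) = if s = 0 then (m₁ : ℂ) * m₂ else 0 := by
  simp only [gridChar]
  rw [Fintype.sum_prod_type]
  simp only
  rw [← Finset.sum_mul_sum, AddChar.sum_mulShift _ (isPrimitive_stdAddChar m₁),
    AddChar.sum_mulShift _ (isPrimitive_stdAddChar m₂), ZMod.card, ZMod.card]
  by_cases h1 : s.1 = 0 <;> by_cases h2 : s.2 = 0 <;> simp [h1, h2, Prod.ext_iff]

lemma gridChar_comm {m₁ m₂ : ℕ} {F : Type*} [Field F] (ψ₁ : AddChar (ZMod m₁) F)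
    (ψ₂ : AddChar (ZMod m₂) F) (l s : Grid m₁ m₂) : gridChar ψ₁ ψ₂ l s = gridChar ψ₁ ψ₂ s l := by
  simp only [gridChar, mul_comm]

lemma card_grid_ne_zero : ((m₁ : ℂ) * m₂) ≠ 0 :=
  mul_ne_zero (Nat.cast_ne_zero.2 (NeZero.ne m₁)) (Nat.cast_ne_zero.2 (NeZero.ne m₂))

open ZMod ComplexConjugate in
/-- The intensity determines the auto-correlation. -/
lemma invDft₂_intensity (z : Grid m₁ m₂ → ℝ) (s : Grid m₁ m₂) :
    invDft₂ (fun l => (intensity z l : ℂ)) s = autocorr z s := by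
  have hI (l : Grid m₁ m₂) : (intensity z l : ℂ) * gridChar stdAddChar stdAddChar l s =
      ∑ q, ∑ q', (z q : ℂ) * z q' * gridChar stdAddChar stdAddChar l (s - q + q') := by
    have h1 : (intensity z l : ℂ) =
        dft₂ (fun q => (z q : ℂ)) l * conj (dft₂ (fun q => (z q : ℂ)) l) := by
      rw [Complex.mul_conj, Complex.normSq_eq_norm_sq, intensity]
    rw [h1, dft₂_eq, map_sum, Finset.sum_mul_sum, Finset.sum_mul]
    refine Finset.sum_congr rfl fun q _ => ?_
    rw [Finset.sum_mul]
    refine Finset.sum_congr rfl fun q' _ => ?_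
    rw [map_mul, Complex.conj_ofReal, conj_gridChar, neg_neg, sub_eq_add_neg, gridChar_add,
      gridChar_add]
    ring
  rw [invDft₂_eq]
  simp only [hI]
  rw [Finset.sum_comm]
  have h2 (q : Grid m₁ m₂) : ∑ l, ∑ q', (z q : ℂ) * z q' *
      gridChar stdAddChar stdAddChar l (s - q + q') = (m₁ * m₂ : ℂ) * (z (q - s) * z q) := by
    rw [Finset.sum_comm]
    simp only [← Finset.mul_sum, sum_gridChar]
    rw [Finset.sum_eq_single (q - s)]
    · rw [if_pos (by abel)]
      ring
    · intro q' _ hq'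
      rw [if_neg, mul_zero]
      intro h
      apply hq'
      rw [← sub_eq_zero, ← h]
      abel
    · simp
  simp only [h2]
  rw [← Finset.mul_sum, inv_mul_cancel_left₀ card_grid_ne_zero, autocorr]
  push_cast
  rfl

open ZMod ComplexConjugate in
/-- Parseval's identity for the inverse transform. -/
lemma sum_norm_sq_invDft₂ (f : Grid m₁ m₂ → ℂ) :
    (m₁ * m₂ : ℝ) * ∑ s, ‖invDft₂ f s‖ ^ 2 = ∑ l, ‖f l‖ ^ 2 := by
  have hconj (c : ℂ) : ((‖c‖ ^ 2 : ℝ) : ℂ) = c * conj c := by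
    rw [Complex.mul_conj, Complex.normSq_eq_norm_sq]
  apply Complex.ofReal_injective
  push_cast
  have hg₁ : (m₁ : ℂ) ≠ 0 := Nat.cast_ne_zero.2 (NeZero.ne m₁)
  have hg₂ : (m₂ : ℂ) ≠ 0 := Nat.cast_ne_zero.2 (NeZero.ne m₂)
  have h1 (s : Grid m₁ m₂) : ((‖invDft₂ f s‖ : ℂ)) ^ 2 = ((m₁ : ℂ) * m₂)⁻¹ ^ 2 *
      ∑ l, ∑ l', f l * conj (f l') * gridChar stdAddChar stdAddChar s (l - l') := by
    rw [← Complex.ofReal_pow, hconj, invDft₂_eq, map_mul, map_sum, map_inv₀, map_mul,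
      Complex.conj_natCast, Complex.conj_natCast]
    rw [mul_mul_mul_comm, ← sq, Finset.sum_mul_sum]
    congr 1
    refine Finset.sum_congr rfl fun l _ => Finset.sum_congr rfl fun l' _ => ?_
    rw [map_mul, conj_gridChar, sub_eq_add_neg, gridChar_add, gridChar_comm _ _ l,
      ← gridChar_neg_left, gridChar_comm _ _ (-l')]
    ring
  simp only [h1]
  rw [← Finset.mul_sum, Finset.sum_comm]
  have h2 (l : Grid m₁ m₂) : ∑ s, ∑ l', f l * conj (f l') *
      gridChar stdAddChar stdAddChar s (l - l') = (m₁ * m₂ : ℂ) * (‖f l‖ : ℂ) ^ 2 := by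
    rw [Finset.sum_comm]
    simp only [← Finset.mul_sum, sum_gridChar, sub_eq_zero]
    simp only [mul_ite, mul_zero, Finset.sum_ite_eq, Finset.mem_univ, if_true]
    rw [← Complex.ofReal_pow, hconj]
    ring
  simp only [h2]
  rw [← Finset.mul_sum]
  field_simp

end Fourier

/-! ### Splitting the combined image into sample and background. -/

section Combine

variable {n₁ n₂ m₁ m₂ : ℕ}

lemma pos_injective (hnm₁ : n₁ ≤ m₁) (hnm₂ : n₂ ≤ m₂) (o : Grid m₁ m₂) :
    Function.Injective (pos (n₁ := n₁) (n₂ := n₂) o) := by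
  intro p p' h
  have h' := Prod.ext_iff.1 (add_left_cancel h)
  have h1 := (ZMod.natCast_eq_natCast_iff' _ _ _).1 h'.1
  have h2 := (ZMod.natCast_eq_natCast_iff' _ _ _).1 h'.2
  rw [Nat.mod_eq_of_lt (p.1.2.trans_le hnm₁), Nat.mod_eq_of_lt (p'.1.2.trans_le hnm₁)] at h1
  rw [Nat.mod_eq_of_lt (p.2.2.trans_le hnm₂), Nat.mod_eq_of_lt (p'.2.2.trans_le hnm₂)] at h2
  exact Prod.ext (Fin.ext h1) (Fin.ext h2)

lemma combine_pos (hnm₁ : n₁ ≤ m₁) (hnm₂ : n₂ ≤ m₂) (o : Grid m₁ m₂)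
    (X : Matrix (Fin n₁) (Fin n₂) ℝ) (Y : Grid m₁ m₂ → ℝ) (p : Fin n₁ × Fin n₂) :
    combine o X Y (pos o p) = X p.1 p.2 :=
  (pos_injective hnm₁ hnm₂ o).extend_apply _ _ p

lemma combine_of_notMem_range (o : Grid m₁ m₂) (X : Matrix (Fin n₁) (Fin n₂) ℝ)
    (Y : Grid m₁ m₂ → ℝ) {q : Grid m₁ m₂}
    (hq : q ∉ Set.range (pos (n₁ := n₁) (n₂ := n₂) o)) : combine o X Y q = Y q :=
  Function.extend_apply' _ _ _ hq

lemma combine_eq_add (hnm₁ : n₁ ≤ m₁) (hnm₂ : n₂ ≤ m₂) (o : Grid m₁ m₂)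
    (X : Matrix (Fin n₁) (Fin n₂) ℝ) {Y : Grid m₁ m₂ → ℝ}
    (hY : ∀ p : Fin n₁ × Fin n₂, Y (pos o p) = 0) : combine o X Y = Y + combine o X 0 := by
  funext q
  by_cases hq : q ∈ Set.range (pos (n₁ := n₁) (n₂ := n₂) o)
  · obtain ⟨p, rfl⟩ := hq
    simp [combine_pos hnm₁ hnm₂, hY]
  · simp [combine_of_notMem_range o X _ hq]

variable [NeZero m₁] [NeZero m₂]

lemma sum_combine_zero_mul (hnm₁ : n₁ ≤ m₁) (hnm₂ : n₂ ≤ m₂) (o : Grid m₁ m₂)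
    (X : Matrix (Fin n₁) (Fin n₂) ℝ) (f : Grid m₁ m₂ → ℝ) :
    ∑ q, combine o X 0 q * f q = ∑ p : Fin n₁ × Fin n₂, X p.1 p.2 * f (pos o p) := by
  refine (Fintype.sum_of_injective (pos o) (pos_injective hnm₁ hnm₂ o) _ _ (fun q hq => ?_)
    fun p => ?_).symm
  · simp [combine_of_notMem_range o X _ hq]
  · simp [combine_pos hnm₁ hnm₂]

lemma l1Norm_combine (hnm₁ : n₁ ≤ m₁) (hnm₂ : n₂ ≤ m₂) (o : Grid m₁ m₂)
    (X : Matrix (Fin n₁) (Fin n₂) ℝ) {Y : Grid m₁ m₂ → ℝ}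
    (hY : ∀ p : Fin n₁ × Fin n₂, Y (pos o p) = 0) :
    l1Norm (combine o X Y) = l1Norm Y + ∑ p : Fin n₁ × Fin n₂, |X p.1 p.2| := by
  have h : ∑ p : Fin n₁ × Fin n₂, |X p.1 p.2| = ∑ q, |combine o X (0 : Grid m₁ m₂ → ℝ) q| := by
    refine Fintype.sum_of_injective (pos o) (pos_injective hnm₁ hnm₂ o) _ _ (fun q hq => ?_)
      fun p => ?_
    · simp [combine_of_notMem_range o X _ hq]
    · simp [combine_pos hnm₁ hnm₂]
  rw [h, l1Norm, l1Norm, ← Finset.sum_add_distrib]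
  refine Finset.sum_congr rfl fun q _ => ?_
  by_cases hq : q ∈ Set.range (pos (n₁ := n₁) (n₂ := n₂) o)
  · obtain ⟨p, rfl⟩ := hq
    simp [combine_pos hnm₁ hnm₂, hY]
  · simp [combine_of_notMem_range o X _ hq]

/-- At a linear shift, the auto-correlation of the combined image is affine in the sample. -/
lemma autocorr_combine (hnm₁ : n₁ ≤ m₁) (hnm₂ : n₂ ≤ m₂) (o : Grid m₁ m₂)
    (X : Matrix (Fin n₁) (Fin n₂) ℝ) {Y : Grid m₁ m₂ → ℝ}
    (hY : ∀ p : Fin n₁ × Fin n₂, Y (pos o p) = 0) (s : linearShifts n₁ n₂ o) :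
    autocorr (combine o X Y) s =
      autocorr Y s + (systemMatrix o Y *ᵥ fun p => X p.1 p.2) s := by
  have h0 (q : Grid m₁ m₂) : combine o X 0 (q - s) * combine o X 0 q = 0 := by
    by_cases hq : q ∈ Set.range (pos (n₁ := n₁) (n₂ := n₂) o)
    · by_cases hq' : q - s ∈ Set.range (pos (n₁ := n₁) (n₂ := n₂) o)
      · obtain ⟨p, hp⟩ := hq
        obtain ⟨p', hp'⟩ := hq'
        exact absurd (by rw [hp, hp']; abel) (s.2 p' p)
      · simp [combine_of_notMem_range o X _ hq']
    · simp [combine_of_notMem_range o X _ hq]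
  have h1 : ∑ q, combine o X 0 (q - s) * Y q = ∑ q, combine o X 0 q * Y (q + s) :=
    Fintype.sum_equiv (Equiv.subRight (s : Grid m₁ m₂)) _ _ fun q => by simp
  have h2 : ∑ q, Y (q - s) * combine o X 0 q = ∑ q, combine o X 0 q * Y (q - s) := by
    simp only [mul_comm]
  have h3 : autocorr (combine o X Y) s = autocorr Y s +
      (∑ q, combine o X 0 (q - s) * Y q + ∑ q, Y (q - s) * combine o X 0 q) := by
    rw [combine_eq_add hnm₁ hnm₂ o X hY, autocorr, autocorr, ← Finset.sum_add_distrib,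
      ← Finset.sum_add_distrib]
    refine Finset.sum_congr rfl fun q _ => ?_
    simp only [Pi.add_apply]
    linear_combination h0 q
  rw [h3, h1, h2, sum_combine_zero_mul hnm₁ hnm₂, sum_combine_zero_mul hnm₁ hnm₂,
    ← Finset.sum_add_distrib]
  congr 1
  simp only [Matrix.mulVec, dotProduct, systemMatrix, Matrix.of_apply]
  exact Finset.sum_congr rfl fun p _ => by ring

end Combine

/-! ### Residual and error estimates. -/

section ErrorBound

variable {n₁ n₂ m₁ m₂ : ℕ}

lemma abs_systemMatrix_mulVec_le (o : Grid m₁ m₂) {ε : Grid m₁ m₂ → ℝ} {c : ℝ}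
    (hε : ∀ q, |ε q| ≤ c) (x : Fin n₁ × Fin n₂ → ℝ) (s : linearShifts n₁ n₂ o) :
    |(systemMatrix o ε *ᵥ x) s| ≤ 2 * c * ∑ p, |x p| := by
  rw [Finset.mul_sum]
  refine (Finset.abs_sum_le_sum_abs _ _).trans (Finset.sum_le_sum fun p _ => ?_)
  rw [abs_mul]
  gcongr
  refine (abs_add_le _ _).trans ?_
  linarith [hε (pos o p + s), hε (pos o p - s)]

variable [NeZero m₁] [NeZero m₂]

lemma abs_autocorr_sub_autocorr_add_le (Y ε : Grid m₁ m₂ → ℝ) {c : ℝ} (hε : ∀ q, |ε q| ≤ c)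
    (s : Grid m₁ m₂) :
    |autocorr Y s - autocorr (Y + ε) s| ≤ 2 * c * l1Norm Y + c ^ 2 * (m₁ * m₂) := by
  have hc : 0 ≤ c := (abs_nonneg _).trans (hε 0)
  have h1 : ∑ q, |Y (q - s)| = l1Norm Y :=
    Fintype.sum_equiv (Equiv.subRight s) _ _ fun q => by simp
  have h2 : ∑ q : Grid m₁ m₂, (|Y (q - s)| * c + c * |Y q| + c * c) =
      2 * c * l1Norm Y + c ^ 2 * (m₁ * m₂) := by
    rw [Finset.sum_add_distrib, Finset.sum_add_distrib, ← Finset.sum_mul, ← Finset.mul_sum, h1]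
    simp only [l1Norm, Finset.sum_const, Finset.card_univ, Fintype.card_prod, ZMod.card,
      nsmul_eq_mul, Nat.cast_mul]
    ring
  rw [← h2, autocorr, autocorr, ← Finset.sum_sub_distrib]
  refine (Finset.abs_sum_le_sum_abs _ _).trans (Finset.sum_le_sum fun q _ => ?_)
  have h3 : Y (q - s) * Y q - (Y + ε) (q - s) * (Y + ε) q =
      -(Y (q - s) * ε q + ε (q - s) * Y q + ε (q - s) * ε q) := by
    simp only [Pi.add_apply]
    ring
  rw [h3, abs_neg]
  refine (abs_add_three _ _ _).trans ?_
  simp only [abs_mul]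
  gcongr <;> apply hε

/-- Cauchy–Schwarz, then Parseval: `m₁ * m₂` times the auto-correlation at `0` is the total
intensity. -/
lemma l1Norm_sq_le (z : Grid m₁ m₂ → ℝ) :
    l1Norm z ^ 2 ≤ ∑ l, intensity z l := by
  have h1 : l1Norm z ^ 2 ≤ (m₁ * m₂ : ℝ) * autocorr z 0 := by
    have := sq_sum_le_card_mul_sum_sq (s := Finset.univ) (f := fun q : Grid m₁ m₂ => |z q|)
    simpa [l1Norm, autocorr, ← sq, ZMod.card] using this
  have h2 : ((m₁ * m₂ : ℝ) * autocorr z 0 : ℂ) = ∑ l, (intensity z l : ℂ) := by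
    rw [← invDft₂_intensity, invDft₂]
    push_cast
    rw [mul_inv_cancel_left₀ card_grid_ne_zero]
    simp
  have h3 : (m₁ * m₂ : ℝ) * autocorr z 0 = ∑ l, intensity z l := by exact_mod_cast h2
  rwa [← h3]

lemma l1Norm_sq_le_of_abs_le (z ε : Grid m₁ m₂ → ℝ) {c : ℝ} (hε : ∀ l, |ε l| ≤ c) :
    l1Norm z ^ 2 ≤ l1Norm (intensity z + ε) + c * (m₁ * m₂) := by
  refine (l1Norm_sq_le z).trans ?_
  have h : ∑ _l : Grid m₁ m₂, c = c * (m₁ * m₂) := by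
    simp [ZMod.card, mul_comm]
  rw [← h, l1Norm, ← Finset.sum_add_distrib]
  refine Finset.sum_le_sum fun l _ => ?_
  have h1 := le_abs_self ((intensity z + ε) l)
  have h2 := neg_abs_le (ε l)
  rw [Pi.add_apply] at h1 ⊢
  linarith [hε l]

lemma invDft₂_add (f g : Grid m₁ m₂ → ℂ) (s : Grid m₁ m₂) :
    invDft₂ (fun l => f l + g l) s = invDft₂ f s + invDft₂ g s := by
  simp only [invDft₂, mul_add, Finset.sum_add_distrib]

lemma sum_coe_le_sum {ι : Type*} [Fintype ι] (S : Set ι) [Fintype S] {f : ι → ℝ}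
    (hf : ∀ i, 0 ≤ f i) : ∑ s : S, f s ≤ ∑ i, f i := by
  have h := Finset.sum_map Finset.univ (Function.Embedding.subtype (· ∈ S)) f
  simp only [Function.Embedding.subtype_apply] at h
  rw [← h]
  exact Finset.sum_le_univ_sum_of_nonneg hf

lemma norm_re_invDft₂_le {ε : Grid m₁ m₂ → ℝ} {c : ℝ} (hε : ∀ l, |ε l| ≤ c)
    (S : Set (Grid m₁ m₂)) [Fintype S] :
    ‖WithLp.toLp 2 fun s : S => (invDft₂ (fun l => (ε l : ℂ)) s).re‖ ≤ c := by
  have hc : 0 ≤ c := (abs_nonneg _).trans (hε 0)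
  have hg : (0 : ℝ) < m₁ * m₂ :=
    mul_pos (Nat.cast_pos.2 (NeZero.pos m₁)) (Nat.cast_pos.2 (NeZero.pos m₂))
  have h1 : ∑ s, ‖invDft₂ (fun l => (ε l : ℂ)) s‖ ^ 2 ≤ c ^ 2 := by
    refine le_of_mul_le_mul_left ?_ hg
    rw [sum_norm_sq_invDft₂]
    have h : ∑ _l : Grid m₁ m₂, c ^ 2 = m₁ * m₂ * c ^ 2 := by simp [ZMod.card]
    rw [← h]
    refine Finset.sum_le_sum fun l _ => pow_le_pow_left₀ (norm_nonneg _) ?_ 2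
    rw [Complex.norm_real]
    exact hε l
  generalize invDft₂ (fun l => (ε l : ℂ)) = F at h1 ⊢
  refine (pow_le_pow_iff_left₀ (norm_nonneg _) hc two_ne_zero).1 (le_trans ?_ h1)
  refine le_trans ?_ (sum_coe_le_sum S fun s => sq_nonneg ‖F s‖)
  rw [EuclideanSpace.real_norm_sq_eq]
  refine Finset.sum_le_sum fun s _ => ?_
  rw [← sq_abs]
  exact pow_le_pow_left₀ (abs_nonneg _) (Complex.abs_re_le_norm _) 2

lemma norm_toLp_le_of_abs_le (S : Set (Grid m₁ m₂)) [Fintype S] {x : S → ℝ} {K : ℝ}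
    (hx : ∀ s, |x s| ≤ K) : ‖WithLp.toLp 2 x‖ ≤ √((m₁ * m₂) * K ^ 2) := by
  refine Real.le_sqrt_of_sq_le ?_
  rw [EuclideanSpace.real_norm_sq_eq]
  calc ∑ s : S, x s ^ 2 ≤ ∑ _s : S, K ^ 2 :=
        Finset.sum_le_sum fun s _ => sq_le_sq' (neg_le_of_abs_le (hx s)) (le_of_abs_le (hx s))
    _ = Fintype.card S * K ^ 2 := by simp
    _ ≤ (m₁ * m₂) * K ^ 2 := by
        gcongr
        have h := Fintype.card_subtype_le (· ∈ S)
        rw [Fintype.card_prod, ZMod.card, ZMod.card] at h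
        exact_mod_cast h

/-- The residual of the true sample in the noisy linear system. -/
lemma norm_residual_le (hnm₁ : n₁ ≤ m₁) (hnm₂ : n₂ ≤ m₂) (o : Grid m₁ m₂)
    (X : Matrix (Fin n₁) (Fin n₂) ℝ) {Y ε₁ ε₂ : Grid m₁ m₂ → ℝ}
    (hY : ∀ p : Fin n₁ × Fin n₂, Y (pos o p) = 0) {c₁ c₂ : ℝ} (hε₁ : ∀ l, |ε₁ l| ≤ c₁)
    (hε₂ : ∀ q, |ε₂ q| ≤ c₂) :
    ‖WithLp.toLp 2 fun s : linearShifts n₁ n₂ o =>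
        (rightHandSide o (intensity (combine o X Y) + ε₁) (Y + ε₂) s).re -
          (systemMatrix o (Y + ε₂) *ᵥ fun p => X p.1 p.2) s‖ ≤
      c₁ + √(8 * (m₁ * m₂) ^ 3 * c₂ ^ 2 * l1Norm (intensity (combine o X Y) + ε₁) +
        (8 * (m₁ * m₂) ^ 4 * c₁ * c₂ ^ 2 + 2 * (m₁ * m₂) ^ 5 * c₂ ^ 4)) / (m₁ * m₂) := by
  have hc₂ : 0 ≤ c₂ := (abs_nonneg _).trans (hε₂ 0)
  have hg : (0 : ℝ) < m₁ * m₂ :=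
    mul_pos (Nat.cast_pos.2 (NeZero.pos m₁)) (Nat.cast_pos.2 (NeZero.pos m₂))
  set Z := combine o X Y with hZ
  set g : ℝ := m₁ * m₂ with hgdef
  -- The bias enters through `autocorr` with factor `‖Y‖₁` and through the matrix with factor
  -- `‖X‖₁`; as the supports are disjoint, these add up to `‖Z‖₁`.
  set K : ℝ := 2 * c₂ * l1Norm Z + c₂ ^ 2 * g
  have hZ0 : 0 ≤ l1Norm Z := Finset.sum_nonneg fun q _ => abs_nonneg _
  set a : linearShifts n₁ n₂ o → ℝ := fun s => (invDft₂ (fun l => (ε₁ l : ℂ)) s).re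
  set b : linearShifts n₁ n₂ o → ℝ := fun s =>
    autocorr Y s - autocorr (Y + ε₂) s - (systemMatrix o ε₂ *ᵥ fun p => X p.1 p.2) s with hb
  have hab : (fun s : linearShifts n₁ n₂ o =>
      (rightHandSide o (intensity Z + ε₁) (Y + ε₂) s).re -
        (systemMatrix o (Y + ε₂) *ᵥ fun p => X p.1 p.2) s) = a + b := by
    funext s
    have h1 : rightHandSide o (intensity Z + ε₁) (Y + ε₂) s =
        (autocorr Z s : ℂ) + invDft₂ (fun l => (ε₁ l : ℂ)) s - (autocorr (Y + ε₂) s : ℂ) := by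
      rw [rightHandSide, ← invDft₂_intensity Z, ← invDft₂_add]
      simp only [Pi.add_apply, Complex.ofReal_add]
    rw [h1, hZ, autocorr_combine hnm₁ hnm₂ o X hY, systemMatrix_add, Matrix.add_mulVec]
    simp only [Pi.add_apply, a, b, Complex.sub_re, Complex.add_re, Complex.ofReal_re]
    ring
  have hbK (s : linearShifts n₁ n₂ o) : |b s| ≤ K := by
    refine (abs_sub _ _).trans ?_
    have h1 := abs_autocorr_sub_autocorr_add_le Y ε₂ hε₂ s
    have h2 := abs_systemMatrix_mulVec_le o hε₂ (fun p => X p.1 p.2) s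
    simp only [K]
    rw [hZ, l1Norm_combine hnm₁ hnm₂ o X hY]
    linarith
  have hZ2 : l1Norm Z ^ 2 ≤ l1Norm (intensity Z + ε₁) + c₁ * g := l1Norm_sq_le_of_abs_le Z ε₁ hε₁
  rw [hab, WithLp.toLp_add]
  refine (norm_add_le _ _).trans
    (add_le_add (norm_re_invDft₂_le hε₁ _) ((norm_toLp_le_of_abs_le _ hbK).trans ?_))
  rw [le_div_iff₀ hg]
  refine Real.le_sqrt_of_sq_le ?_
  rw [mul_pow, Real.sq_sqrt (by positivity)]
  have h2 : K ^ 2 ≤ 8 * c₂ ^ 2 * l1Norm Z ^ 2 + 2 * c₂ ^ 4 * g ^ 2 := by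
    simp only [K]
    nlinarith [sq_nonneg (2 * c₂ * l1Norm Z - c₂ ^ 2 * g)]
  have h3 : K ^ 2 ≤ 8 * c₂ ^ 2 * (l1Norm (intensity Z + ε₁) + c₁ * g) + 2 * c₂ ^ 4 * g ^ 2 := by
    refine h2.trans ?_
    gcongr
  calc g * K ^ 2 * g ^ 2 = g ^ 3 * K ^ 2 := by ring
    _ ≤ g ^ 3 * (8 * c₂ ^ 2 * (l1Norm (intensity Z + ε₁) + c₁ * g) + 2 * c₂ ^ 4 * g ^ 2) := by
        gcongr
    _ = _ := by ring

/-- A least squares estimate differs from the true sample by at most the norm of the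
pseudo-inverse times the residual. -/
lemma IsLeastSquares.frobNorm_sub_le {o : Grid m₁ m₂} {I Y : Grid m₁ m₂ → ℝ}
    {Xs : Matrix (Fin n₁) (Fin n₂) ℝ} (h : IsLeastSquares o I Y Xs)
    (hM : IsUnit ((systemMatrix (n₁ := n₁) (n₂ := n₂) o Y)ᵀ *
      systemMatrix (n₁ := n₁) (n₂ := n₂) o Y)) (X : Matrix (Fin n₁) (Fin n₂) ℝ) :
    frobNorm (Xs - X) ≤
      maxSingularValue ((systemMatrix (n₁ := n₁) (n₂ := n₂) o Y)ᵀ *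
          systemMatrix (n₁ := n₁) (n₂ := n₂) o Y)⁻¹ *
        maxSingularValue (systemMatrix (n₁ := n₁) (n₂ := n₂) o Y) *
        ‖WithLp.toLp 2 fun s : linearShifts n₁ n₂ o =>
          (rightHandSide o I Y s).re - (systemMatrix o Y *ᵥ fun p => X p.1 p.2) s‖ := by
  set M := systemMatrix (n₁ := n₁) (n₂ := n₂) o Y with hMdef
  have h1 : (fun p : Fin n₁ × Fin n₂ => Xs p.1 p.2) =
      (Mᵀ * M)⁻¹ *ᵥ (Mᵀ *ᵥ fun s => (rightHandSide o I Y s).re) :=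
    eq_of_isMinOn_sum_norm_sq hM _ fun x' => by
      have h0 := isMinOn_iff.1 h (Matrix.of fun i j => x' (i, j)) (Set.mem_univ _)
      simpa only [Matrix.of_apply] using h0
  have h2 : (fun p : Fin n₁ × Fin n₂ => X p.1 p.2) =
      (Mᵀ * M)⁻¹ *ᵥ (Mᵀ *ᵥ (M *ᵥ fun p => X p.1 p.2)) := by
    rw [Matrix.mulVec_mulVec _ Mᵀ, Matrix.mulVec_mulVec,
      Matrix.nonsing_inv_mul _ ((Matrix.isUnit_iff_isUnit_det _).1 hM), Matrix.one_mulVec]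
  have h3 : (fun p : Fin n₁ × Fin n₂ => (Xs - X) p.1 p.2) =
      (Mᵀ * M)⁻¹ *ᵥ (Mᵀ *ᵥ fun s => (rightHandSide o I Y s).re -
        (M *ᵥ fun p => X p.1 p.2) s) := by
    change (fun p : Fin n₁ × Fin n₂ => Xs p.1 p.2) - (fun p => X p.1 p.2) = _
    rw [h1]
    nth_rewrite 1 [h2]
    rw [← Matrix.mulVec_sub, ← Matrix.mulVec_sub]
    rfl
  rw [frobNorm_eq_norm, h3, mul_assoc]
  refine (norm_mulVec_le_maxSingularValue_mul _ _).trans ?_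
  gcongr
  · exact maxSingularValue_nonneg _
  · exact norm_transpose_mulVec_le_maxSingularValue_mul _ _

end ErrorBound

end BackgroundPR

theorem theorem2p6 (n₁ n₂ k₁ k₂ m₁ m₂ : ℕ) [NeZero m₁] [NeZero m₂]
    (hn₁ : 1 ≤ n₁) (hn₂ : 1 ≤ n₂) (hm₁ : m₁ = n₁ + k₁) (hm₂ : m₂ = n₂ + k₂)
    (hm : 2 * n₁ * n₂ + (2 * n₁ - 1) * (2 * n₂ - 1) ≤ m₁ * m₂) :
    -- the constants depend on the noise levels and on the dimensions only
    ∃ (C₂ : ℝ≥0 → ℝ≥0) (C₁ : ℝ≥0 → ℝ≥0 → ℝ≥0),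
      Continuous C₂ ∧ Continuous (fun c : ℝ≥0 × ℝ≥0 => C₁ c.1 c.2) ∧
      C₂ 0 = 0 ∧ (∀ c₁, C₁ c₁ 0 = 0) ∧
      ∀ {Ω : Type*} [MeasurableSpace Ω] (P : Measure Ω) [IsProbabilityMeasure P]
        -- location of the sample, the sample, and the parameters of the background
        (o : BackgroundPR.Grid m₁ m₂) (X : Matrix (Fin n₁) (Fin n₂) ℝ)
        (μ : ℝ) (σ c₁ c₂ : ℝ≥0) (_ : 0 < σ)
        -- background, noise of the intensity, bias of the background
        (Y ε₁ ε₂ : Ω → BackgroundPR.Grid m₁ m₂ → ℝ)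
        -- the background vanishes on the window and is i.i.d. normal outside of it
        (_ : ∀ ω, ∀ p : Fin n₁ × Fin n₂, Y ω (BackgroundPR.pos o p) = 0)
        (_ : ∀ q, q ∉ Set.range (BackgroundPR.pos (n₁ := n₁) (n₂ := n₂) o) →
          HasLaw (fun ω => Y ω q) (gaussianReal μ (σ ^ 2)) P)
        (_ : iIndepFun
          (fun (q : {q // q ∉ Set.range (BackgroundPR.pos (n₁ := n₁) (n₂ := n₂) o)}) ω =>
            Y ω q) P)
        -- the noise of the intensity is bounded
        (_ : Measurable ε₁) (_ : ∀ᵐ ω ∂P, ∀ l, |ε₁ ω l| ≤ c₁)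
        -- the bias lives outside of the window, is bounded and independent of the background
        (_ : Measurable ε₂) (_ : ∀ ω, ∀ p : Fin n₁ × Fin n₂, ε₂ ω (BackgroundPR.pos o p) = 0)
        (_ : ∀ᵐ ω ∂P, ∀ q, |ε₂ ω q| ≤ c₂) (_ : IndepFun Y ε₂ P),
        ∀ᵐ ω ∂P,
          let Iₙ : BackgroundPR.Grid m₁ m₂ → ℝ :=
            BackgroundPR.intensity (BackgroundPR.combine o X (Y ω)) + ε₁ ω
          let Yₙ : BackgroundPR.Grid m₁ m₂ → ℝ := Y ω + ε₂ ω
          let M : Matrix (BackgroundPR.linearShifts n₁ n₂ o) (Fin n₁ × Fin n₂) ℝ :=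
            BackgroundPR.systemMatrix o Yₙ
          let δ₁ : ℝ := BackgroundPR.maxSingularValue (Mᵀ * M)⁻¹
          let δ₂ : ℝ := BackgroundPR.maxSingularValue M
          IsUnit (Mᵀ * M) ∧
            ∀ Xs : Matrix (Fin n₁) (Fin n₂) ℝ, BackgroundPR.IsLeastSquares o Iₙ Yₙ Xs →
              BackgroundPR.frobNorm (Xs - X) ≤
                δ₁ * δ₂ * (c₁ + c₂ * (2 * BackgroundPR.l1Norm Yₙ + c₂ * (m₁ * m₂))
                  + √(C₂ c₂ * BackgroundPR.l1Norm Iₙ + C₁ c₁ c₂) / (m₁ * m₂)) := by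
  have hnm₁ : n₁ ≤ m₁ := hm₁ ▸ Nat.le_add_right n₁ k₁
  have hnm₂ : n₂ ≤ m₂ := hm₂ ▸ Nat.le_add_right n₂ k₂
  -- With `g = m₁ * m₂`, the bias contributes at most `√(g K²) = √(g³ K²) / g`. The constants come
  -- from `K² ≤ 8 c₂² ‖Z‖₁² + 2 c₂⁴ g²` and `‖Z‖₁² ≤ ‖Iₙ‖₁ + c₁ g`.
  refine ⟨fun c₂ => 8 * (m₁ * m₂) ^ 3 * c₂ ^ 2,
    fun c₁ c₂ => 8 * (m₁ * m₂) ^ 4 * c₁ * c₂ ^ 2 + 2 * (m₁ * m₂) ^ 5 * c₂ ^ 4,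
    by fun_prop, by fun_prop, by simp, by simp, ?_⟩
  intro Ω _ P _ o X μ σ c₁ c₂ hσ Y ε₁ ε₂ hY₀ hlaw hind _ hε₁ hε₂m _ hε₂ hYε
  filter_upwards [BackgroundPR.ae_isUnit_transpose_mul_systemMatrix hn₁ hn₂ hnm₁ hnm₂ hm P o μ hσ
    Y ε₂ hY₀ hlaw hind hε₂m hYε, hε₁, hε₂] with ω hM h₁ h₂
  refine ⟨hM, fun Xs hXs => (hXs.frobNorm_sub_le hM X).trans ?_⟩
  refine mul_le_mul_of_nonneg_left ?_ (mul_nonneg (BackgroundPR.maxSingularValue_nonneg _)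
    (BackgroundPR.maxSingularValue_nonneg _))
  refine (BackgroundPR.norm_residual_le hnm₁ hnm₂ o X (hY₀ ω) h₁ h₂).trans ?_
  push_cast
  have hY1 : 0 ≤ BackgroundPR.l1Norm (Y ω + ε₂ ω) := Finset.sum_nonneg fun q _ => abs_nonneg _
  gcongr
  -- The term `c₂ * (2 * ‖Yₙ‖₁ + c₂ * (m₁ * m₂))` is nonnegative and only weakens the bound.
  exact le_add_of_nonneg_right (by positivity)
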